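/- Let \(P\) be a right Ore monoid: for all \(x_1,x_2\in P\) there are \(y_1,y_2\in P\) with \(x_1y_1=x_2y_2\), and \(xy_1=xy_2\) implies \(y_1z=y_2z\) for some \(z\in P\). Let \(G\) be its group of right fractions \(pq^{-1}\), where \(p_1q_1^{-1}=p_2q_2^{-1}\) if and only if \(p_1t_1=p_2t_2\) and \(q_1t_1=q_2t_2\) for some \(t_1,t_2\in P\). Let \(X\) be a locally compact Hausdorff space with an action of \(P\) by proper topological correspondences: for each \(p\in P\) a locally compact Hausdorff space \(M_p\) with a proper continuous map \(r_p\colon M_p\to X\) and a local homeomorphism \(s_p\colon M_p\to X\), where \(M_1=X\) and \(r_1=s_1=\mathrm{id}_X\); and for all \(p,q\in P\) a homeomorphism \(\sigma_{p,q}=(r_{p,q},s_{p,q})\colon M_{pq}\to M_p\times_{s_p,X,r_q}M_q\) with \(r_p r_{p,q}=r_{pq}\) and \(s_q s_{p,q}=s_{pq}\), such that \(\sigma_{p,1},\sigma_{1,q}\) are the canonical homeomorphisms and the two ways of decomposing \(M_{pqt}\) into \(M_p\times_X M_q\times_X M_t\) agree. Let \(H^0=\varprojlim (M_p,r_{p,q})\)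 be the space of all \((m_p)_{p\in P}\in\prod_p M_p\) with \(r_{p,q}(m_{pq})=m_p\) for all \(p,q\), with the subspace topology, and let \(\tilde s_t\colon H^0\to H^0\), \((m_p)_p\mapsto (s_{t,p}(m_{tp}))_p\), for \(t\in P\). Let \(H\) be the groupoid with object space \(H^0\) and arrow set \[H^1=\{(x,g,y)\in H^0\times G\times H^0 \mid \exists\, p_1,p_2\in P:\ g=p_1p_2^{-1},\ \tilde s_{p_1}(x)=\tilde s_{p_2}(y)\},\] with range \(x\), source \(y\) and \((x,g,y)(y,h,z)=(x,gh,z)\), where \(H^1\) carries the quotient topology from the disjoint union over \((p_1,p_2)\in P\times P\) of the spaces \(H^1_{p_1,p_2}=\{(x,y)\in H^0\times H^0\mid\tilde s_{p_1}(x)=\tilde s_{p_2}(y)\}\), each mapped to \(H^1\) by \((x,y)\mapsto(x,p_1p_2^{-1},y)\). The groupoid \(H\) is called locally contracting if for every non-empty open \(U\subseteq H^0\) there are an open subset \(V\subseteq U\) and a bisection \(B\) (an open subset of \(H^1\) on which range \(r\) and source \(s\) are homeomorphisms onto open subsets of \(H^0\)) with \(\overline V\subseteq s(B)\) and \(r(B\overline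 V)\subsetneq V\), where \(r(B\overline V)=\{r(b)\mid b\in B,\ s(b)\in\overline V\}\). Let \(X'=\bigcap_{p\in P} r_p(M_p)\) and \(M'_p=s_p^{-1}(X')\), with the subspace topologies. The action is called locally contracting if for every non-empty, relatively compact, open subset \(S\subseteq X'\) there are \(n\in\mathbb N\), elements \(p_i,q_i,a_i,b_i\in P\) and subsets \(W_i\subseteq M'_{p_i}\times_{s_{p_i},X',s_{q_i}}M'_{q_i}\) for \(1\le i\le n\) such that (LC1) \(p_1a_1=\dots=p_na_n=q_1b_1=\dots=q_nb_n\); (LC2) the coordinate projections \(\mathrm{pr}_1\colon W_i\to M'_{p_i}\) and \(\mathrm{pr}_2\colon W_i\to M'_{q_i}\) are injective and open; (LC3) the subsets \(\mathrm{pr}_1(W_i)M'_{a_i}:=\{\sigma_{p_i,a_i}^{-1}(x_1,x_2)\mid x_1\in \mathrm{pr}_1(W_i),\ x_2\in M'_{a_i},\ s_{p_i}(x_1)=r_{a_i}(x_2)\}\) of \(M'_{p_ia_i}\) are pairwise disjoint, and so are the subsets \(\mathrm{pr}_2(W_i)M'_{b_i}\), defined in the same way; (LC4) \(\overline{\bigsqcup_i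 \mathrm{pr}_1(W_i)M'_{a_i}}\subsetneq\bigsqcup_i \mathrm{pr}_2(W_i)M'_{b_i}\), with the closure taken in \(M'_{p_1a_1}\); (LC5) \(r_{q_i}(\mathrm{pr}_2(W_i))\subseteq S\); (LC6) \(p_iq_i^{-1}\ne p_jq_j^{-1}\) in \(G\) for \(i\ne j\). Theorem. The groupoid \(H\) is locally contracting if and only if the action is locally contracting. -/

import Mathlib

open Set Topology

/-! ### Right Ore monoids and their group of fractions -/

/-- A right Ore monoid. -/
class RightOre (P : Type*) [Monoid P] : Prop where
  ore : ∀ x₁ x₂ : P, ∃ y₁ y₂ : P, x₁ * y₁ = x₂ * y₂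
  cancel : ∀ x y₁ y₂ : P, x * y₁ = x * y₂ → ∃ z : P, y₁ * z = y₂ * z

/-- Equivalence of formal right quotients `p q⁻¹`, represented by pairs `(p, q)`. -/
def fracSetoid (P : Type*) [Monoid P] [RightOre P] : Setoid (P × P) where
  r x y := ∃ t₁ t₂ : P, x.1 * t₁ = y.1 * t₂ ∧ x.2 * t₁ = y.2 * t₂
  iseqv := by
    refine ⟨fun x => ⟨1, 1, rfl, rfl⟩, ?_, ?_⟩
    · rintro x y ⟨t₁, t₂, h, k⟩
      exact ⟨t₂, t₁, h.symm, k.symm⟩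
    · rintro x y z ⟨t₁, t₂, h, k⟩ ⟨u₁, u₂, h', k'⟩
      obtain ⟨v, w, e⟩ := RightOre.ore t₂ u₁
      refine ⟨t₁ * v, u₂ * w, ?_, ?_⟩
      · rw [← mul_assoc, h, mul_assoc, e, ← mul_assoc, h', mul_assoc]
      · rw [← mul_assoc, k, mul_assoc, e, ← mul_assoc, k', mul_assoc]

/-- The group completion `G` of a right Ore monoid `P`: formal quotients `p q⁻¹`. -/
def FracGroup (P : Type*) [Monoid P] [RightOre P] : Type _ := Quotient (fracSetoid P)

namespace FracGroup

variable {P : Type*} [Monoid P] [RightOre P]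

/-- The formal quotient `p q⁻¹`. -/
def frac (p q : P) : FracGroup P := Quotient.mk (fracSetoid P) (p, q)

theorem frac_eq_iff {p q p' q' : P} :
    frac p q = frac p' q' ↔ ∃ t₁ t₂ : P, p * t₁ = p' * t₂ ∧ q * t₁ = q' * t₂ :=
  Quotient.eq (r := fracSetoid P)

theorem frac_mul_right (p q t : P) : frac (p * t) (q * t) = frac p q :=
  frac_eq_iff.2 ⟨1, t, by simp, by simp⟩

theorem exists_frac (x : FracGroup P) : ∃ p q : P, x = frac p q := by
  induction x using Quotient.inductionOn with
  | h a => exact ⟨a.1, a.2, rfl⟩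

/-- The product of representatives: `[p₁ t₁, q₂ t₂]` for any `t₁, t₂` with `q₁ t₁ = p₂ t₂`. -/
noncomputable def mulAux (x y : P × P) : FracGroup P :=
  frac (x.1 * (RightOre.ore x.2 y.1).choose) (y.2 * (RightOre.ore x.2 y.1).choose_spec.choose)

theorem mulAux_eq {x y : P × P} {t₁ t₂ : P} (h : x.2 * t₁ = y.1 * t₂) :
    mulAux x y = frac (x.1 * t₁) (y.2 * t₂) := by
  have h' := (RightOre.ore x.2 y.1).choose_spec.choose_spec
  unfold mulAux
  set s₁ := (RightOre.ore x.2 y.1).choose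
  set s₂ := (RightOre.ore x.2 y.1).choose_spec.choose
  obtain ⟨u, u', e⟩ := RightOre.ore s₁ t₁
  have : y.1 * (s₂ * u) = y.1 * (t₂ * u') := by
    rw [← mul_assoc, ← h', mul_assoc, e, ← mul_assoc, h, mul_assoc]
  obtain ⟨z, hz⟩ := RightOre.cancel _ _ _ this
  refine frac_eq_iff.2 ⟨u * z, u' * z, ?_, ?_⟩
  · calc x.1 * s₁ * (u * z) = x.1 * (s₁ * u) * z := by simp only [mul_assoc]
      _ = x.1 * t₁ * (u' * z) := by rw [e]; simp only [mul_assoc]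
  · calc y.2 * s₂ * (u * z) = y.2 * (s₂ * u * z) := by simp only [mul_assoc]
      _ = y.2 * t₂ * (u' * z) := by rw [hz]; simp only [mul_assoc]

theorem mulAux_right_left (x y : P × P) (c : P) :
    mulAux (x.1 * c, x.2 * c) y = mulAux x y := by
  obtain ⟨t₁, t₂, h⟩ := RightOre.ore (x.2 * c) y.1
  rw [mulAux_eq (x := (x.1 * c, x.2 * c)) (y := y) h,
    mulAux_eq (x := x) (y := y) (t₁ := c * t₁) (t₂ := t₂) (by rw [← mul_assoc, h]), mul_assoc]

theorem mulAux_right_right (x y : P × P) (c : P) :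
    mulAux x (y.1 * c, y.2 * c) = mulAux x y := by
  obtain ⟨t₁, t₂, h⟩ := RightOre.ore x.2 (y.1 * c)
  rw [mulAux_eq (x := x) (y := (y.1 * c, y.2 * c)) h,
    mulAux_eq (x := x) (y := y) (t₁ := t₁) (t₂ := c * t₂) (by rw [h, mul_assoc]), mul_assoc]

noncomputable instance : Mul (FracGroup P) where
  mul x y := Quotient.liftOn₂' (s₁ := fracSetoid P) (s₂ := fracSetoid P) x y mulAux (by
    rintro x y x' y' ⟨t₁, t₂, h, k⟩ ⟨u₁, u₂, h', k'⟩
    rw [← mulAux_right_left x y t₁, ← mulAux_right_right _ y u₁, h, k, h', k',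
      mulAux_right_right _ y', mulAux_right_left x'])

instance : One (FracGroup P) := ⟨frac 1 1⟩

instance : Inv (FracGroup P) where
  inv := Quotient.map' (s₁ := fracSetoid P) (s₂ := fracSetoid P) (fun x => (x.2, x.1))
    (by rintro x y ⟨t₁, t₂, h, k⟩; exact ⟨t₁, t₂, k, h⟩)

theorem frac_mul_frac {p₁ q₁ p₂ q₂ t₁ t₂ : P} (h : q₁ * t₁ = p₂ * t₂) :
    frac p₁ q₁ * frac p₂ q₂ = frac (p₁ * t₁) (q₂ * t₂) := by
  have e : frac p₁ q₁ * frac p₂ q₂ = mulAux (p₁, q₁) (p₂, q₂) :=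
    rfl
  rw [e, mulAux_eq (x := (p₁, q₁)) (y := (p₂, q₂)) h]

theorem inv_frac (p q : P) : (frac p q)⁻¹ = frac q p := rfl

theorem frac_mul_cancel (p q t : P) : frac p q * frac q t = frac p t := by
  rw [frac_mul_frac (t₁ := 1) (t₂ := 1) rfl, mul_one, mul_one]

theorem one_eq_frac (p : P) : (1 : FracGroup P) = frac p p :=
  frac_eq_iff.2 ⟨p, 1, by simp, by simp⟩

noncomputable instance : Group (FracGroup P) :=
  Group.ofLeftAxioms
    (by
      intro x y z
      obtain ⟨p, q, rfl⟩ := exists_frac x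
      obtain ⟨p', q', rfl⟩ := exists_frac y
      obtain ⟨p'', q'', rfl⟩ := exists_frac z
      obtain ⟨c, d, h⟩ := RightOre.ore q p'
      obtain ⟨c', d', h'⟩ := RightOre.ore (q' * d) p''
      rw [← frac_mul_right p q (c * c'), ← frac_mul_right p' q' (d * c'),
        ← frac_mul_right p'' q'' d', ← mul_assoc q, ← mul_assoc q', ← mul_assoc p', h, h']
      simp only [frac_mul_cancel])
    (by
      intro x
      obtain ⟨p, q, rfl⟩ := exists_frac x
      rw [one_eq_frac p, frac_mul_cancel])
    (by
      intro x
      obtain ⟨p, q, rfl⟩ := exists_frac x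
      rw [inv_frac, frac_mul_cancel, ← one_eq_frac])

end FracGroup

/-! ### Groupoids and local contractivity -/

/-- A groupoid whose sets of objects and arrows carry topologies. This is the structure on which the
notions of bisection and local contractivity below depend; continuity of the structure maps and
étaleness are properties that play no role in these definitions. -/
structure SpaceGroupoid.{u, v} where
  Obj : Type u
  Arr : Type v
  [topObj : TopologicalSpace Obj]
  [topArr : TopologicalSpace Arr]
  /-- range -/
  r : Arr → Obj
  /-- source -/
  s : Arr → Obj
  unit : Obj → Arr
  inv : Arr → Arr
  mul : (g h : Arr) → s g = r h → Arr
  r_unit : ∀ x, r (unit x) = x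
  s_unit : ∀ x, s (unit x) = x
  r_inv : ∀ g, r (inv g) = s g
  s_inv : ∀ g, s (inv g) = r g
  r_mul : ∀ g h e, r (mul g h e) = r g
  s_mul : ∀ g h e, s (mul g h e) = s h
  unit_mul : ∀ g, mul (unit (r g)) g (s_unit (r g)) = g
  mul_unit : ∀ g, mul g (unit (s g)) (r_unit (s g)).symm = g
  mul_inv : ∀ g, mul g (inv g) (r_inv g).symm = unit (r g)
  inv_mul : ∀ g, mul (inv g) g (s_inv g) = unit (s g)
  mul_assoc : ∀ g h k (e : s g = r h) (f : s h = r k),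
    mul (mul g h e) k ((s_mul g h e).trans f) = mul g (mul h k f) (e.trans (r_mul h k f).symm)

attribute [instance] SpaceGroupoid.topObj SpaceGroupoid.topArr

namespace SpaceGroupoid

variable (𝒢 : SpaceGroupoid)

/-- A bisection: an open set of arrows on which range and source are homeomorphisms onto open
sets of objects. -/
def IsBisection (B : Set 𝒢.Arr) : Prop :=
  IsOpen B ∧ IsOpenEmbedding (B.domRestrict 𝒢.r) ∧ IsOpenEmbedding (B.domRestrict 𝒢.s)

/-- Local contractivity in the sense of Anantharaman-Delaroche. The set `r (B · closure V)` is
the image under `r` of all arrows in `B` with source in `closure V`. -/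
def LocallyContracting : Prop :=
  ∀ U : Set 𝒢.Obj, IsOpen U → U.Nonempty →
    ∃ (V : Set 𝒢.Obj) (B : Set 𝒢.Arr), IsOpen V ∧ V ⊆ U ∧ 𝒢.IsBisection B ∧
      closure V ⊆ 𝒢.s '' B ∧ 𝒢.r '' {b ∈ B | 𝒢.s b ∈ closure V} ⊂ V

end SpaceGroupoid

/-! ### Actions by proper topological correspondences -/

/-- An action of the monoid `P` on the space `X` by proper topological correspondences
`X ← M p → X`. The space `M 1` is identified with `X` through the homeomorphism `r 1 = s 1`, and
`σ p 1`, `σ 1 q` are the canonical homeomorphisms. The fields `assoc₁`, `assoc₂`, `assoc₃` are the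
components in `M p`, `M q`, `M t` of the associativity square. -/
structure CorrAction (P : Type*) [Monoid P] (X : Type*) [TopologicalSpace X] where
  M : P → Type*
  [top : ∀ p, TopologicalSpace (M p)]
  [t2 : ∀ p, T2Space (M p)]
  [locallyCompact : ∀ p, LocallyCompactSpace (M p)]
  r : ∀ p, M p → X
  s : ∀ p, M p → X
  isProperMap_r : ∀ p, IsProperMap (r p)
  isLocalHomeomorph_s : ∀ p, IsLocalHomeomorph (s p)
  σ : ∀ p q, M (p * q) ≃ₜ {x : M p × M q // s p x.1 = r q x.2}
  r_σ : ∀ p q m, r p (σ p q m).1.1 = r (p * q) m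
  s_σ : ∀ p q m, s q (σ p q m).1.2 = s (p * q) m
  isHomeomorph_r_one : IsHomeomorph (r 1)
  s_one : s 1 = r 1
  σ_one_right : ∀ p (m : M (p * 1)), (σ p 1 m).1.1 = cast (congrArg M (mul_one p)) m
  σ_one_left : ∀ q (m : M (1 * q)), (σ 1 q m).1.2 = cast (congrArg M (one_mul q)) m
  assoc₁ : ∀ p q t (m : M (p * q * t)),
    (σ p q (σ (p * q) t m).1.1).1.1 = (σ p (q * t) (cast (congrArg M (mul_assoc p q t)) m)).1.1
  assoc₂ : ∀ p q t (m : M (p * q * t)),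
    (σ p q (σ (p * q) t m).1.1).1.2 =
      (σ q t (σ p (q * t) (cast (congrArg M (mul_assoc p q t)) m)).1.2).1.1
  assoc₃ : ∀ p q t (m : M (p * q * t)),
    (σ (p * q) t m).1.2 =
      (σ q t (σ p (q * t) (cast (congrArg M (mul_assoc p q t)) m)).1.2).1.2

attribute [instance] CorrAction.top CorrAction.t2 CorrAction.locallyCompact

namespace CorrAction

variable {P : Type*} [Monoid P] {X : Type*} [TopologicalSpace X] (A : CorrAction P X)

/-- The map `r_{p,q} : M_{pq} → M_p`. -/
def rr (p q : P) (m : A.M (p * q)) : A.M p := (A.σ p q m).1.1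

/-- The map `s_{p,q} : M_{pq} → M_q`. -/
def ss (p q : P) (m : A.M (p * q)) : A.M q := (A.σ p q m).1.2

/-- The object space `H⁰`: the projective limit of the `M p` along the maps `r_{p,q}`, with the
subspace topology from the product. -/
def History : Type _ := {m : ∀ p, A.M p // ∀ p q, A.rr p q (m (p * q)) = m p}

instance : TopologicalSpace A.History :=
  inferInstanceAs (TopologicalSpace {m : ∀ p, A.M p // ∀ p q, A.rr p q (m (p * q)) = m p})

theorem cast_history (m : ∀ p, A.M p) {p q : P} (h : p = q) :
    cast (congrArg A.M h) (m p) = m q := by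
  subst h; rfl

/-- The map `s̃_t : H⁰ → H⁰`, `(m_p)_p ↦ (s_{t,p}(m_{tp}))_p`. -/
def shift (t : P) (m : A.History) : A.History :=
  ⟨fun p => A.ss t p (m.1 (t * p)), fun p q => by
    have h := A.assoc₂ t p q (m.1 (t * p * q))
    rw [A.cast_history m.1 (mul_assoc t p q)] at h
    have h' := m.2 (t * p) q
    unfold rr at h'
    rw [h'] at h
    exact h.symm⟩

theorem shift_mul (t u : P) (m : A.History) : A.shift (t * u) m = A.shift u (A.shift t m) := by
  refine Subtype.ext (funext fun p => ?_)
  have h := A.assoc₃ t u p (m.1 (t * u * p))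
  rw [A.cast_history m.1 (mul_assoc t u p)] at h
  exact h

variable [RightOre P]

open FracGroup

/-- The set `H¹` of arrows `(x, g, y)` of the transformation groupoid. -/
structure Arrow where
  x : A.History
  g : FracGroup P
  y : A.History
  prop : ∃ p₁ p₂ : P, g = frac p₁ p₂ ∧ A.shift p₁ x = A.shift p₂ y

theorem Arrow.ext' {a b : A.Arrow} (hx : a.x = b.x) (hg : a.g = b.g) (hy : a.y = b.y) :
    a = b := by
  cases a; cases b; simp_all

/-- The canonical map from the disjoint union of the fibre products
`H¹_{p₁,p₂} = {(x, y) | s̃_{p₁}(x) = s̃_{p₂}(y)}` to `H¹`. -/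
def toArrow (a : Σ p : P × P, {z : A.History × A.History // A.shift p.1 z.1 = A.shift p.2 z.2}) :
    A.Arrow :=
  ⟨a.2.1.1, frac a.1.1 a.1.2, a.2.1.2, a.1.1, a.1.2, rfl, a.2.2⟩

/-- The quotient topology from the disjoint union of the `H¹_{p₁,p₂}`. -/
instance : TopologicalSpace A.Arrow :=
  TopologicalSpace.coinduced A.toArrow inferInstance

/-- The transformation groupoid `H`. -/
noncomputable def transformationGroupoid : SpaceGroupoid where
  Obj := A.History
  Arr := A.Arrow
  r a := a.x
  s a := a.y
  unit x := ⟨x, 1, x, 1, 1, rfl, rfl⟩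
  inv a := ⟨a.y, a.g⁻¹, a.x, by
    obtain ⟨p₁, p₂, h, k⟩ := a.prop
    exact ⟨p₂, p₁, by rw [h, inv_frac], k.symm⟩⟩
  mul a b e := ⟨a.x, a.g * b.g, b.y, by
    obtain ⟨p₁, p₂, h, k⟩ := a.prop
    obtain ⟨p₃, p₄, h', k'⟩ := b.prop
    obtain ⟨t, u, f⟩ := RightOre.ore p₂ p₃
    refine ⟨p₁ * t, p₄ * u, by rw [h, h', frac_mul_frac f], ?_⟩
    rw [shift_mul, k, ← shift_mul, f, e, shift_mul, k', ← shift_mul]⟩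
  r_unit _ := rfl
  s_unit _ := rfl
  r_inv _ := rfl
  s_inv _ := rfl
  r_mul _ _ _ := rfl
  s_mul _ _ _ := rfl
  unit_mul a := Arrow.ext' A rfl (one_mul _) rfl
  mul_unit a := Arrow.ext' A rfl (mul_one _) rfl
  mul_inv a := Arrow.ext' A rfl (mul_inv_cancel _) rfl
  inv_mul a := Arrow.ext' A rfl (inv_mul_cancel _) rfl
  mul_assoc a b c _ _ := Arrow.ext' A rfl (_root_.mul_assoc _ _ _) rfl

end CorrAction

namespace CorrAction

variable {P : Type*} [Monoid P] {X : Type*} [TopologicalSpace X] (A : CorrAction P X)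

/-- The set `X'` of possible situations. -/
def possible : Set X := {x | ∀ p, x ∈ Set.range (A.r p)}

/-- The space `M'_p = s_p⁻¹(X')`, with the subspace topology. -/
abbrev MPos (p : P) : Type _ := {m : A.M p // A.s p m ∈ A.possible}

/-- The subset `Y M'_a = {σ_{p,a}⁻¹(x₁, x₂) | x₁ ∈ Y, x₂ ∈ M'_a, s_p(x₁) = r_a(x₂)}` of
`M'_{pa} = M'_e` for `Y ⊆ M'_p` and `p a = e`. -/
def extend {p a e : P} (h : p * a = e) (Y : Set (A.MPos p)) : Set (A.MPos e) :=
  {m | ∃ x₁ ∈ Y, ∃ (x₂ : A.MPos a) (k : A.s p x₁.1 = A.r a x₂.1),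
    m.1 = cast (congrArg A.M h) ((A.σ p a).symm ⟨(x₁.1, x₂.1), k⟩)}

/-- The action is locally contracting. The common value of all `p i * a i` and `q i * b i` is
called `e`. -/
def LocallyContracting [RightOre P] : Prop :=
  ∀ S : Set A.possible, IsOpen S → IsCompact (closure S) → S.Nonempty →
    ∃ (n : ℕ) (p q a b : Fin n → P) (W : ∀ i, Set (A.MPos (p i) × A.MPos (q i)))
      (e : P) (hp : ∀ i, p i * a i = e) (hq : ∀ i, q i * b i = e),
      (∀ i, ∀ w ∈ W i, A.s (p i) w.1.1 = A.s (q i) w.2.1) ∧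
      (∀ i, Function.Injective (fun w : W i => w.1.1) ∧ IsOpenMap (fun w : W i => w.1.1) ∧
        Function.Injective (fun w : W i => w.1.2) ∧ IsOpenMap (fun w : W i => w.1.2)) ∧
      (∀ i j, i ≠ j → Disjoint (A.extend (hp i) (Prod.fst '' W i))
        (A.extend (hp j) (Prod.fst '' W j))) ∧
      (∀ i j, i ≠ j → Disjoint (A.extend (hq i) (Prod.snd '' W i))
        (A.extend (hq j) (Prod.snd '' W j))) ∧
      closure (⋃ i, A.extend (hp i) (Prod.fst '' W i)) ⊂
        (⋃ i, A.extend (hq i) (Prod.snd '' W i)) ∧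
      (∀ i, ∀ w ∈ W i, A.r (q i) w.2.1 ∈ Subtype.val '' S) ∧
      (∀ i j, i ≠ j → FracGroup.frac (p i) (q i) ≠ FracGroup.frac (p j) (q j))

end CorrAction

/-!
A history `x ∈ H⁰` has a position `pos p x` in each `M'_p` and a situation in `X'`. The situation
map is proper and surjective, the square formed by `pos p`, `shift p`, `s_p` and the situation map
is cartesian, and, by the Ore condition, the preimages of open sets under the maps `pos p` form a
base of `H⁰`. Likewise the cylinders, the sets of all `(x, p q⁻¹, y)` with `shift p x = shift q y`
and `(pos p x, pos q y) ∈ O` for open `O`, form a base of `H¹`. A set `W ⊆ M'_p ×_{X'} M'_q` with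
injective and open projections thus amounts to a bisection with range `pos p ⁻¹ (pr₁ W)` and
source `pos q ⁻¹ (pr₂ W)`, and (LC1)–(LC6) describe a bisection that is a finite union of
cylinders over distinct elements of `G`, all brought to the common level `e = p_i a_i = q_i b_i`.

A contracting bisection of `H` over the preimage of a relatively compact `S` matters only on a
compact set of arrows. Finitely many cylinders cover that set, and the room between a compact and
an open set allows one to choose the contracted open set at a finite level.

Conversely, the data (LC1)–(LC6) make `H` contract the preimages in `H⁰` of relatively compact
open `S ⊆ X'`. Any non-empty open subset of `H⁰` contains `pos t ⁻¹ N` for some open `N` on which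
`s_t` is injective; `shift t` identifies this set with the preimage of the open set `s_t(N)`, and
conjugation by the arrows `(x, t, shift t x)` carries the contraction over.
-/

theorem injOn_iUnion_of_pairwise_disjoint_image {ι α β : Type*} {f : α → β} {s : ι → Set α}
    (hinj : ∀ i, InjOn f (s i)) (hdisj : Pairwise fun i j => Disjoint (f '' s i) (f '' s j)) :
    InjOn f (⋃ i, s i) := by
  intro a ha b hb hab
  obtain ⟨i, hi⟩ := mem_iUnion.1 ha
  obtain ⟨j, hj⟩ := mem_iUnion.1 hb
  have hij : i = j := by
    by_contra hne
    exact disjoint_left.1 (hdisj hne) (mem_image_of_mem f hi) (hab ▸ mem_image_of_mem f hj)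
  exact hinj i hi (hij ▸ hj) hab

theorem preimage_ssubset_preimage_iff {α β : Type*} {f : α → β} (hf : Function.Surjective f)
    {s t : Set β} : f ⁻¹' s ⊂ f ⁻¹' t ↔ s ⊂ t := by
  rw [ssubset_def, ssubset_def, hf.preimage_subset_preimage_iff, hf.preimage_subset_preimage_iff]

section FiberProducts

variable {Y Z W : Type*} [TopologicalSpace Y] [TopologicalSpace W] {f : Y → Z} {g : W → Z}

theorem exists_isOpen_eq_iff_mem (hf : IsLocallyInjective f) :
    ∃ D : Set (Y × Y), IsOpen D ∧ ∀ w : Y × Y, f w.1 = f w.2 → (w ∈ D ↔ w.1 = w.2) := by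
  obtain ⟨D, hD, hdiag⟩ := isOpen_induced_iff.1 (isLocallyInjective_iff_isOpen_diagonal.1 hf)
  exact ⟨D, hD, fun w hw => Set.ext_iff.1 hdiag ⟨w, hw⟩⟩

theorem isOpen_preimage_pullback_val (hf : IsLocallyInjective f) {S : Set (Y × W)}
    (hS : ∀ w ∈ S, f w.1 = g w.2) (hsnd : IsOpenMap fun w : S => w.1.2) :
    IsOpen ((↑) ⁻¹' S : Set (f.Pullback g)) := by
  refine isOpen_iff_mem_nhds.2 ?_
  rintro ⟨⟨y, w⟩, hyw⟩ (hmem : (y, w) ∈ S)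
  obtain ⟨N, hN, hyN, hinj⟩ := hf y
  have hopen : IsOpen ((fun w : S => w.1.2) '' {w | w.1.1 ∈ N}) :=
    hsnd _ (hN.preimage (continuous_fst.comp continuous_subtype_val))
  have hN' : ∀ᶠ z : f.Pullback g in 𝓝 ⟨(y, w), hyw⟩, z.1.1 ∈ N :=
    (continuous_fst.comp continuous_subtype_val).continuousAt (hN.mem_nhds hyN)
  have hS' : ∀ᶠ z : f.Pullback g in 𝓝 ⟨(y, w), hyw⟩,
      z.1.2 ∈ (fun w : S => w.1.2) '' {w | w.1.1 ∈ N} :=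
    (continuous_snd.comp continuous_subtype_val).continuousAt
      (hopen.mem_nhds ⟨⟨(y, w), hmem⟩, hyN, rfl⟩)
  filter_upwards [hN', hS'] with ⟨⟨y', w'⟩, hfg⟩ hy' ⟨⟨⟨y'', _⟩, hS''⟩, hy'', (h : _ = w')⟩
  subst h
  have : y'' = y' := hinj hy'' hy' ((hS _ hS'').trans hfg.symm)
  exact this ▸ hS''

theorem isOpenEmbedding_inclusion_pullback {O : Set (Y × W)} (hO : IsOpen O) :
    IsOpenEmbedding (inclusion fun _ hw => hw.2 :
      {w : Y × W | w ∈ O ∧ f w.1 = g w.2} → f.Pullback g) := by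
  refine .inclusion _ ?_
  convert hO.preimage continuous_subtype_val using 1
  exact Set.ext fun w => and_iff_left w.2

variable [TopologicalSpace Z]

theorem isOpenMap_pullback_fst (hf : Continuous f) (hg : IsOpenMap g) :
    IsOpenMap (Function.Pullback.fst : f.Pullback g → Y) := by
  refine IsOpenMap.of_nhds_le fun ⟨⟨y, w⟩, hyw⟩ => ?_
  rw [Filter.le_map_iff]
  intro N hN
  obtain ⟨O, hO, hON⟩ := mem_nhds_induced _ _ _ |>.1 hN
  obtain ⟨A, hA, B, hB, hAB⟩ := mem_nhds_prod_iff.1 hO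
  have hB' : f ⁻¹' (g '' B) ∈ 𝓝 y := hf.continuousAt (hyw ▸ hg.image_mem_nhds hB)
  filter_upwards [hA, hB'] with y' hy' ⟨w', hw', hgf⟩
  exact ⟨⟨(y', w'), hgf.symm⟩, hON (hAB ⟨hy', hw'⟩), rfl⟩

theorem isOpenMap_pullback_snd (hf : IsOpenMap f) (hg : Continuous g) :
    IsOpenMap (Function.Pullback.snd : f.Pullback g → W) := by
  let swap : f.Pullback g ≃ₜ g.Pullback f :=
    (Homeomorph.prodComm Y W).subtype fun _ => eq_comm
  exact (isOpenMap_pullback_fst hg hf).comp swap.isOpenMap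

theorem isOpenMap_fst_of_isOpen (hf : Continuous f) (hg : IsOpenMap g) {O : Set (Y × W)}
    (hO : IsOpen O) : IsOpenMap fun w : {w : Y × W | w ∈ O ∧ f w.1 = g w.2} => w.1.1 :=
  (isOpenMap_pullback_fst hf hg).comp (isOpenEmbedding_inclusion_pullback hO).isOpenMap

theorem isOpenMap_snd_of_isOpen (hf : IsOpenMap f) (hg : Continuous g) {O : Set (Y × W)}
    (hO : IsOpen O) : IsOpenMap fun w : {w : Y × W | w ∈ O ∧ f w.1 = g w.2} => w.1.2 :=
  (isOpenMap_pullback_snd hf hg).comp (isOpenEmbedding_inclusion_pullback hO).isOpenMap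

end FiberProducts

namespace RightOre

variable {P : Type*} [Monoid P] [RightOre P]

theorem exists_dvd_and_dvd (p q : P) : ∃ e, p ∣ e ∧ q ∣ e := by
  obtain ⟨c, d, h⟩ := ore p q
  exact ⟨p * c, dvd_mul_right p c, h ▸ dvd_mul_right q d⟩

theorem exists_forall_dvd {ι : Type*} [Finite ι] (p : ι → P) : ∃ e, ∀ i, p i ∣ e :=
  Directed.finite_le (r := (· ∣ ·)) (f := id) exists_dvd_and_dvd p

theorem exists_forall_mul_eq {ι : Type*} [Finite ι] (p q : ι → P) :
    ∃ (e : P) (a b : ι → P), (∀ i, p i * a i = e) ∧ ∀ i, q i * b i = e := by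
  obtain ⟨e, he⟩ := exists_forall_dvd (Sum.elim p q)
  choose f hf using he
  exact ⟨e, f ∘ Sum.inl, f ∘ Sum.inr, fun i => (hf (.inl i)).symm, fun i => (hf (.inr i)).symm⟩

theorem exists_forall_mul_eq_mul {ι : Type*} (F : Finset ι) (x y z : ι → P)
    (h : ∀ i ∈ F, x i * y i = x i * z i) : ∃ t, ∀ i ∈ F, y i * t = z i * t := by
  classical
  induction F using Finset.induction_on with
  | empty => exact ⟨1, by simp⟩
  | insert i F _ ih =>
    obtain ⟨t, ht⟩ := ih fun j hj => h j (Finset.mem_insert_of_mem hj)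
    obtain ⟨u, hu⟩ := cancel (x i) (y i * t) (z i * t) (by
      rw [← mul_assoc, h i (Finset.mem_insert_self i F), mul_assoc])
    refine ⟨t * u, Finset.forall_mem_insert _ _ _ |>.2 ⟨?_, fun j hj => ?_⟩⟩
    · simpa only [mul_assoc] using hu
    · rw [← mul_assoc, ht j hj, mul_assoc]

/-- A cocone over finitely many arrows `p → p q` of the category with objects `P`, which the Ore
conditions make filtered. -/
theorem exists_cone (F : Finset (P × P)) : ∃ (e : P) (f : P → P), ∀ a ∈ F,
    a.1 * f a.1 = e ∧ a.1 * a.2 * f (a.1 * a.2) = e ∧ f a.1 = a.2 * f (a.1 * a.2) := by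
  classical
  obtain ⟨e, he⟩ := exists_forall_dvd
    (Subtype.val : ↥(F.image Prod.fst ∪ F.image fun a => a.1 * a.2) → P)
  choose! f hf using fun p hp => he ⟨p, hp⟩
  have hf₁ : ∀ a ∈ F, a.1 * f a.1 = e := fun a ha =>
    (hf _ (Finset.mem_union_left _ (Finset.mem_image_of_mem Prod.fst ha))).symm
  have hf₂ : ∀ a ∈ F, a.1 * a.2 * f (a.1 * a.2) = e := fun a ha =>
    (hf _ (Finset.mem_union_right _ (Finset.mem_image_of_mem (fun a : P × P => a.1 * a.2) ha))).symm
  obtain ⟨t, ht⟩ := exists_forall_mul_eq_mul F Prod.fst (fun a => f a.1)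
    (fun a => a.2 * f (a.1 * a.2)) fun a ha => by rw [hf₁ a ha, ← mul_assoc, hf₂ a ha]
  refine ⟨e * t, fun p => f p * t, fun a ha => ⟨?_, ?_, ?_⟩⟩
  · rw [← mul_assoc, hf₁ a ha]
  · rw [← mul_assoc, hf₂ a ha]
  · exact (ht a ha).trans (mul_assoc _ _ _)

end RightOre

namespace FracGroup

variable {P : Type*} [Monoid P] [RightOre P]

theorem frac_mul_left (t p q : P) :
    frac (t * p) (t * q) = frac t 1 * frac p q * (frac t 1)⁻¹ := by
  have h (u : P) : frac t 1 = frac (t * u) u := by rw [← frac_mul_right t 1 u, one_mul]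
  nth_rw 1 [h p]
  rw [h q, inv_frac, frac_mul_cancel, frac_mul_cancel]

end FracGroup

namespace SpaceGroupoid

variable {𝒢 : SpaceGroupoid}

variable (𝒢) in
/-- The condition that local contractivity imposes on a single open set `U` of objects. -/
def ContractsIn (U : Set 𝒢.Obj) : Prop :=
  ∃ (V : Set 𝒢.Obj) (B : Set 𝒢.Arr), IsOpen V ∧ V ⊆ U ∧ 𝒢.IsBisection B ∧
    closure V ⊆ 𝒢.s '' B ∧ 𝒢.r '' {b ∈ B | 𝒢.s b ∈ closure V} ⊂ V

theorem locallyContracting_iff : 𝒢.LocallyContracting ↔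
    ∀ U : Set 𝒢.Obj, IsOpen U → U.Nonempty → 𝒢.ContractsIn U :=
  Iff.rfl

theorem ContractsIn.mono {U U' : Set 𝒢.Obj} (h : 𝒢.ContractsIn U) (hU : U ⊆ U') :
    𝒢.ContractsIn U' := by
  obtain ⟨V, B, hV, hVU, h⟩ := h
  exact ⟨V, B, hV, hVU.trans hU, h⟩

theorem IsBisection.isCompact_source_preimage {B : Set 𝒢.Arr} (hB : 𝒢.IsBisection B)
    {C : Set 𝒢.Obj} (hC : IsCompact C) (hCB : C ⊆ 𝒢.s '' B) :
    IsCompact {b ∈ B | 𝒢.s b ∈ C} := by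
  have h := hB.2.2.isInducing.isCompact_preimage' hC (by rwa [range_domRestrict])
  convert h.image continuous_subtype_val using 1
  ext b
  simp [and_comm]

end SpaceGroupoid

namespace CorrAction

variable {P : Type*} [Monoid P] {X : Type*} [TopologicalSpace X] (A : CorrAction P X)

/-! ### The space of histories -/

section Restriction

theorem continuous_rr (p q : P) : Continuous (A.rr p q) :=
  continuous_fst.comp (continuous_subtype_val.comp (A.σ p q).continuous)

theorem continuous_ss (p q : P) : Continuous (A.ss p q) :=
  continuous_snd.comp (continuous_subtype_val.comp (A.σ p q).continuous)

theorem isOpenMap_ss (p q : P) : IsOpenMap (A.ss p q) :=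
  (isOpenMap_pullback_snd (A.isLocalHomeomorph_s p).isOpenMap
    (A.isProperMap_r q).continuous).comp (A.σ p q).isOpenMap

theorem s_rr (p q : P) (m : A.M (p * q)) : A.s p (A.rr p q m) = A.r q (A.ss p q m) :=
  (A.σ p q m).2

variable {A} in
theorem ext_rr_ss {p q : P} {m m' : A.M (p * q)} (hr : A.rr p q m = A.rr p q m')
    (hs : A.ss p q m = A.ss p q m') : m = m' :=
  (A.σ p q).injective (Subtype.ext (Prod.ext hr hs))

theorem exists_rr_eq_ss_eq {p q : P} {m : A.M p} {m' : A.M q} (h : A.s p m = A.r q m') :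
    ∃ n, A.rr p q n = m ∧ A.ss p q n = m' :=
  ⟨(A.σ p q).symm ⟨(m, m'), h⟩, by simp [rr], by simp [ss]⟩

/-- The map `r_{p,c} : M_e → M_p` for `p c = e`. Keeping `e` as a variable hides the casts along
the associativity of `P`. -/
def res {p e : P} (c : P) (h : p * c = e) (m : A.M e) : A.M p :=
  A.rr p c (cast (congrArg A.M h.symm) m)

theorem r_res {p e : P} (c : P) (h : p * c = e) (m : A.M e) : A.r p (A.res c h m) = A.r e m := by
  subst h
  exact A.r_σ p c m

theorem continuous_res {p e : P} (c : P) (h : p * c = e) : Continuous (A.res c h) := by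
  subst h
  exact A.continuous_rr p c

theorem res_res {p q e : P} (c d : P) (h : p * c = q) (k : q * d = e) (m : A.M e) :
    A.res c h (A.res d k m) = A.res (c * d) (by rw [← mul_assoc, h, k]) m := by
  subst h k
  exact A.assoc₁ p c d m

theorem res_congr {p e c d : P} (hcd : c = d) (h : p * c = e) (m : A.M e) :
    A.res c h m = A.res d (hcd ▸ h) m := by
  subst hcd
  rfl

theorem ss_res (p c d : P) (m : A.M (p * (c * d))) :
    A.ss p c (A.res d (mul_assoc p c d) m) = A.rr c d (A.ss p (c * d) m) := by
  have h := A.assoc₂ p c d (cast (congrArg A.M (mul_assoc p c d).symm) m)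
  rwa [cast_cast, cast_eq] at h

theorem res_history (x : A.History) {p e : P} (c : P) (h : p * c = e) :
    A.res c h (x.1 e) = x.1 p := by
  subst h
  exact x.2 p c

end Restriction

section Situation

theorem r_history (x : A.History) (p : P) : A.r p (x.1 p) = A.r 1 (x.1 1) := by
  rw [← A.res_history x p (one_mul p), r_res]

/-- The canonical map `H⁰ → X'`, sending a history to the common value of all `r_p(m_p)`. -/
def situation (x : A.History) : A.possible :=
  ⟨A.r 1 (x.1 1), fun p => ⟨x.1 p, A.r_history x p⟩⟩

theorem r_eq_situation (x : A.History) (p : P) : A.r p (x.1 p) = (A.situation x : X) :=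
  A.r_history x p

theorem s_eq_situation_shift (x : A.History) (p : P) :
    A.s p (x.1 p) = (A.situation (A.shift p x) : X) := by
  rw [← x.2 p 1]
  exact A.s_rr p 1 _

theorem continuous_history (p : P) : Continuous fun x : A.History => x.1 p :=
  (continuous_apply p).comp continuous_subtype_val

theorem continuous_situation : Continuous A.situation :=
  ((A.isProperMap_r 1).continuous.comp (A.continuous_history 1)).subtype_mk _

theorem continuous_shift (t : P) : Continuous (A.shift t) :=
  (continuous_pi fun p => (A.continuous_ss t p).comp (A.continuous_history (t * p))).subtype_mk _

instance : T2Space A.History := inferInstanceAs (T2Space (Subtype _))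

theorem isClosed_setOf_rr_eq (a : P × P) :
    IsClosed {m : ∀ p, A.M p | A.rr a.1 a.2 (m (a.1 * a.2)) = m a.1} :=
  isClosed_eq ((A.continuous_rr _ _).comp (continuous_apply _)) (continuous_apply _)

theorem isClosedEmbedding_history :
    IsClosedEmbedding fun x : A.History => x.1 := by
  have h : IsClosed {m : ∀ p, A.M p | ∀ p q, A.rr p q (m (p * q)) = m p} := by
    simp only [ofPred_forall]
    exact isClosed_iInter fun p => isClosed_iInter fun q => A.isClosed_setOf_rr_eq (p, q)
  exact h.isClosedEmbedding_subtypeVal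

theorem isClosed_possible : IsClosed A.possible := by
  have : A.possible = ⋂ p, range (A.r p) := by ext; simp [possible]
  exact this ▸ isClosed_iInter fun p => (A.isProperMap_r p).isClosedMap.isClosed_range

theorem isCompact_preimage_situation {K : Set A.possible} (hK : IsCompact K) :
    IsCompact (A.situation ⁻¹' K) := by
  have h : A.situation ⁻¹' K =
      (fun x : A.History => x.1) ⁻¹' univ.pi fun p => A.r p ⁻¹' (Subtype.val '' K) := by
    ext x
    simp [mem_pi, r_eq_situation]
  rw [h]
  exact A.isClosedEmbedding_history.isCompact_preimage (isCompact_univ_pi fun p =>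
    (A.isProperMap_r p).isCompact_preimage (hK.image continuous_subtype_val))

instance [LocallyCompactSpace X] : LocallyCompactSpace A.History := by
  have : LocallyCompactSpace A.possible :=
    A.isClosed_possible.isClosedEmbedding_subtypeVal.locallyCompactSpace
  have : WeaklyLocallyCompactSpace A.History := ⟨fun x => by
    obtain ⟨K, hK, hxK⟩ := exists_compact_mem_nhds (A.situation x)
    exact ⟨_, A.isCompact_preimage_situation hK, A.continuous_situation.continuousAt hxK⟩⟩
  infer_instance

variable [RightOre P]

theorem situation_surjective : Function.Surjective A.situation := by
  classical
  rintro ⟨x, hx⟩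
  choose m hm using id hx
  have hK : IsCompact (univ.pi fun p => A.r p ⁻¹' {x}) :=
    isCompact_univ_pi fun p => (A.isProperMap_r p).isCompact_preimage isCompact_singleton
  obtain ⟨y, hyx, hy⟩ := hK.inter_iInter_nonempty _ A.isClosed_setOf_rr_eq fun F => by
    obtain ⟨e, f, hf⟩ := RightOre.exists_cone F
    let y : ∀ p, A.M p := fun p => if h : p * f p = e then A.res (f p) h (m e) else m p
    have hy {p : P} (h : p * f p = e) : y p = A.res (f p) h (m e) := dif_pos h
    refine ⟨y, fun p _ => ?_, mem_iInter₂.2 fun a ha => ?_⟩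
    · by_cases h : p * f p = e
      · exact (congrArg (A.r p) (hy h)).trans ((A.r_res _ _ _).trans (hm e))
      · exact (congrArg (A.r p) (dif_neg h)).trans (hm p)
    · obtain ⟨h₁, h₂, h₃⟩ := hf a ha
      simp only [mem_ofPred_eq, hy h₁, hy h₂]
      exact (A.res_res a.2 _ rfl h₂ (m e)).trans (A.res_congr h₃.symm _ _)
  exact ⟨⟨y, fun p q => mem_iInter.1 hy (p, q)⟩, Subtype.ext (hyx 1 trivial)⟩

end Situation

section Glueing

variable [RightOre P]

theorem exists_history_of_cofinal {p : P} (m : ∀ c, A.M (p * c))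
    (hm : ∀ c d, A.res d (mul_assoc p c d) (m (c * d)) = m c) :
    ∃ x : A.History, ∀ c, x.1 (p * c) = m c := by
  have res_mul {q c d c' : P} (w : P) (h : q * d = p * c) (hc : c * w = c') :
      A.res (d * w) (by rw [← mul_assoc, h, mul_assoc, hc]) (m c') = A.res d h (m c) := by
    subst hc
    rw [← hm c w, res_res]
  have res_eq {q c d c' d' : P} (h : q * d = p * c) (h' : q * d' = p * c') :
      A.res d h (m c) = A.res d' h' (m c') := by
    obtain ⟨v, w, hvw⟩ := RightOre.ore c c'
    obtain ⟨t, ht⟩ := RightOre.cancel q (d * v) (d' * w) (by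
      rw [← mul_assoc, ← mul_assoc, h, h', mul_assoc, mul_assoc, hvw])
    have hvw' : c' * (w * t) = c * (v * t) := by rw [← mul_assoc, ← mul_assoc, hvw]
    rw [← res_mul (v * t) h rfl, ← res_mul (w * t) h' hvw']
    exact A.res_congr (by rw [← mul_assoc, ← mul_assoc, ht]) _ _
  choose d c h using fun q => RightOre.ore q p
  exact ⟨⟨fun q => A.res (d q) (h q) (m (c q)), fun q t =>
      (A.res_res t (d (q * t)) rfl (h (q * t)) _).trans (res_eq _ _)⟩,
    fun b => (res_eq (h (p * b)) (mul_assoc p b 1)).trans (hm b 1)⟩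

theorem exists_history_of_s_eq {p : P} {m : A.M p} {z : A.History}
    (h : A.s p m = A.situation z) : ∃ x : A.History, x.1 p = m ∧ A.shift p x = z := by
  choose n hr hs using fun c =>
    A.exists_rr_eq_ss_eq (m' := z.1 c) (h.trans (A.r_eq_situation z c).symm)
  obtain ⟨x, hx⟩ := A.exists_history_of_cofinal n fun c d => by
    refine ext_rr_ss ?_ ?_
    · exact (A.res_res c d rfl (mul_assoc p c d) _).trans ((hr _).trans (hr c).symm)
    · rw [ss_res, hs, hs, z.2]
  exact ⟨x, by rw [← x.2 p 1, hx, hr],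
    Subtype.ext (funext fun c => (congrArg (A.ss p c) (hx c)).trans (hs c))⟩

variable {A} in
theorem history_ext {p : P} {x y : A.History} (h : x.1 p = y.1 p)
    (k : A.shift p x = A.shift p y) : x = y := by
  refine Subtype.ext (funext fun q => ?_)
  obtain ⟨c, d, e⟩ := RightOre.ore p q
  have hpc : x.1 (p * c) = y.1 (p * c) := ext_rr_ss
    ((x.2 p c).trans (h.trans (y.2 p c).symm)) (congrFun (congrArg Subtype.val k) c)
  rw [← A.res_history x d e.symm, ← A.res_history y d e.symm, hpc]

theorem mem_nhds_history_iff (p : P) {x : A.History} {U : Set A.History} :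
    U ∈ 𝓝 x ↔ ∃ c, ∃ N ∈ 𝓝 (x.1 (p * c)), {y : A.History | y.1 (p * c) ∈ N} ⊆ U := by
  have hanti {q e : P} (d : P) (h : q * d = e) :
      (𝓝 (x.1 e)).comap (fun y : A.History => y.1 e) ≤
        (𝓝 (x.1 q)).comap fun y : A.History => y.1 q := by
    have : (fun y : A.History => y.1 q) = A.res d h ∘ fun y : A.History => y.1 e :=
      funext fun y => (A.res_history y d h).symm
    rw [this, ← Filter.comap_comap, ← A.res_history x d h]
    exact Filter.comap_mono (A.continuous_res d h).continuousAt.le_comap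
  have hnhds : 𝓝 x = ⨅ c, (𝓝 (x.1 (p * c))).comap fun y : A.History => y.1 (p * c) := by
    rw [A.isClosedEmbedding_history.isInducing.nhds_eq_comap, nhds_pi, Filter.pi,
      Filter.comap_iInf]
    simp only [Filter.comap_comap]
    refine le_antisymm (le_iInf fun c => iInf_le _ (p * c)) (le_iInf fun q => ?_)
    obtain ⟨c, d, h⟩ := RightOre.ore p q
    exact (iInf_le _ c).trans (hanti d h.symm)
  rw [hnhds, Filter.mem_iInf_of_directed]
  · simp only [Filter.mem_comap]
    rfl
  · intro b c
    obtain ⟨d, e, h⟩ := RightOre.ore b c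
    exact ⟨b * d, hanti d (mul_assoc p b d),
      hanti e (by rw [mul_assoc, h])⟩

theorem isOpenMap_shift (p : P) : IsOpenMap (A.shift p) := by
  refine IsOpenMap.of_nhds_le fun x => Filter.le_map_iff.2 fun U hU => ?_
  obtain ⟨c, N, hN, hNU⟩ := (A.mem_nhds_history_iff p).1 hU
  have hss : A.ss p c '' N ∈ 𝓝 ((A.shift p x).1 c) := (A.isOpenMap_ss p c).image_mem_nhds hN
  filter_upwards [(A.continuous_history c).continuousAt hss] with z ⟨m, hm, hmz⟩
  obtain ⟨y, hy, rfl⟩ := A.exists_history_of_s_eq (m := A.rr p c m) (z := z)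
    (by rw [s_rr, hmz, r_eq_situation])
  have hym : y.1 (p * c) = m := ext_rr_ss ((y.2 p c).trans hy) hmz.symm
  exact ⟨y, hNU (hym ▸ hm : y.1 (p * c) ∈ N), rfl⟩

theorem isLocallyInjective_shift (p : P) : IsLocallyInjective (A.shift p) := by
  intro x
  obtain ⟨N, hN, hxN, hinj⟩ := (A.isLocalHomeomorph_s p).isLocallyInjective (x.1 p)
  refine ⟨{y | y.1 p ∈ N}, hN.preimage (A.continuous_history p), hxN, fun y hy z hz hyz => ?_⟩
  exact history_ext (hinj hy hz (by rw [s_eq_situation_shift, hyz, s_eq_situation_shift])) hyz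

end Glueing

section Positions

/-- The canonical map `H⁰ → M'_p`. -/
def pos (p : P) (x : A.History) : A.MPos p :=
  ⟨x.1 p, A.s_eq_situation_shift x p ▸ (A.situation (A.shift p x)).2⟩

/-- The map `M'_p → X'` induced by `s_p`. -/
def sPos (p : P) : A.MPos p → A.possible := A.possible.restrictPreimage (A.s p)

/-- The map `M'_{tp} → M'_p` induced by `s_{t,p}`. -/
def ssPos (t p : P) (m : A.MPos (t * p)) : A.MPos p :=
  ⟨A.ss t p m.1, (A.s_σ t p m.1).symm ▸ m.2⟩

theorem sPos_pos (p : P) (x : A.History) : A.sPos p (A.pos p x) = A.situation (A.shift p x) :=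
  Subtype.ext (A.s_eq_situation_shift x p)

theorem r_pos_mem_image_iff {p : P} {x : A.History} {S : Set A.possible} :
    A.r p (A.pos p x).1 ∈ Subtype.val '' S ↔ x ∈ A.situation ⁻¹' S := by
  rw [show A.r p (A.pos p x).1 = A.situation x from A.r_eq_situation x p,
    Subtype.val_injective.mem_set_image, mem_preimage]

theorem continuous_pos (p : P) : Continuous (A.pos p) := (A.continuous_history p).subtype_mk _

theorem continuous_ssPos (t p : P) : Continuous (A.ssPos t p) :=
  ((A.continuous_ss t p).comp continuous_subtype_val).subtype_mk _

theorem continuous_sPos (p : P) : Continuous (A.sPos p) :=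
  (A.isLocalHomeomorph_s p).continuous.restrictPreimage

theorem isOpenMap_sPos (p : P) : IsOpenMap (A.sPos p) :=
  (A.isLocalHomeomorph_s p).isOpenMap.restrictPreimage _

theorem isLocallyInjective_sPos (p : P) : IsLocallyInjective (A.sPos p) := fun m => by
  obtain ⟨N, hN, hmN, hinj⟩ := (A.isLocalHomeomorph_s p).isLocallyInjective m.1
  exact ⟨_, hN.preimage continuous_subtype_val, hmN, fun a ha b hb hab =>
    Subtype.ext (hinj ha hb (congrArg Subtype.val hab))⟩

instance (p : P) : LocallyCompactSpace (A.MPos p) :=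
  (A.isClosed_possible.preimage
    (A.isLocalHomeomorph_s p).continuous).isClosedEmbedding_subtypeVal.locallyCompactSpace

theorem preimage_pos_extend {p a e : P} (h : p * a = e) (Y : Set (A.MPos p)) :
    A.pos e ⁻¹' A.extend h Y = A.pos p ⁻¹' Y := by
  subst h
  refine Subset.antisymm ?_ fun x hx => ⟨_, hx, A.pos a (A.shift p x), ?_, ext_rr_ss ?_ ?_⟩
  · rintro x ⟨m, hm, n, hmn, hx⟩
    have : A.pos p x = m := Subtype.ext <|
      (x.2 p a).symm.trans <| (congrArg (A.rr p a) hx).trans <| by simp [rr]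
    exact mem_preimage.2 (this ▸ hm)
  · rw [pos, pos, s_eq_situation_shift, r_eq_situation]
  · exact (x.2 p a).trans (by simp [rr, pos])
  · simp [ss, pos, shift]

variable [RightOre P]

theorem pos_surjective (p : P) : Function.Surjective (A.pos p) := fun m => by
  obtain ⟨z, hz⟩ := A.situation_surjective (A.sPos p m)
  obtain ⟨x, hx, -⟩ := A.exists_history_of_s_eq (congrArg Subtype.val hz).symm
  exact ⟨x, Subtype.ext hx⟩

variable {A} in
theorem history_ext_pos {p : P} {x y : A.History} (h : A.pos p x = A.pos p y)
    (k : A.shift p x = A.shift p y) : x = y :=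
  history_ext (congrArg Subtype.val h) k

theorem exists_pos_eq_shift_eq {p : P} {m : A.MPos p} {z : A.History}
    (h : A.sPos p m = A.situation z) : ∃ x, A.pos p x = m ∧ A.shift p x = z := by
  obtain ⟨x, hx, hz⟩ := A.exists_history_of_s_eq (congrArg Subtype.val h)
  exact ⟨x, Subtype.ext hx, hz⟩

/-- The map `M'_e → M'_p` induced by `r_{p,c}`, for `p c = e`. -/
def resPos {p e : P} (c : P) (h : p * c = e) (m : A.MPos e) : A.MPos p :=
  ⟨A.res c h m.1, by
    obtain ⟨x, rfl⟩ := A.pos_surjective e m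
    exact (A.res_history x c h).symm ▸ (A.pos p x).2⟩

theorem resPos_pos {p e : P} (c : P) (h : p * c = e) (x : A.History) :
    A.resPos c h (A.pos e x) = A.pos p x :=
  Subtype.ext (A.res_history x c h)

theorem continuous_resPos {p e : P} (c : P) (h : p * c = e) : Continuous (A.resPos c h) :=
  ((A.continuous_res c h).comp continuous_subtype_val).subtype_mk _

end Positions

section Levels

variable [RightOre P]

theorem exists_pos_preimage_subset (p : P) {x : A.History} {U : Set A.History} (hU : U ∈ 𝓝 x) :
    ∃ c, ∃ N : Set (A.MPos (p * c)), IsOpen N ∧ A.pos (p * c) x ∈ N ∧ A.pos (p * c) ⁻¹' N ⊆ U := by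
  obtain ⟨c, N, hN, hNU⟩ := (A.mem_nhds_history_iff p).1 hU
  exact ⟨c, Subtype.val ⁻¹' interior N, isOpen_interior.preimage continuous_subtype_val,
    mem_interior_iff_mem_nhds.2 hN, fun _ hy => hNU (interior_subset (s := N) hy)⟩

theorem exists_pos_prod_preimage_subset (p q : P) {x y : A.History}
    {U : Set (A.History × A.History)} (hU : U ∈ 𝓝 (x, y)) :
    ∃ c, ∃ O : Set (A.MPos (p * c) × A.MPos (q * c)), IsOpen O ∧
      (A.pos (p * c) x, A.pos (q * c) y) ∈ O ∧
      ∀ x' y', (A.pos (p * c) x', A.pos (q * c) y') ∈ O → (x', y') ∈ U := by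
  obtain ⟨U₁, hU₁, U₂, hU₂, hU₁₂⟩ := mem_nhds_prod_iff.1 hU
  obtain ⟨c₁, N₁, hN₁, hx, hNU₁⟩ := A.exists_pos_preimage_subset p hU₁
  obtain ⟨c₂, N₂, hN₂, hy, hNU₂⟩ := A.exists_pos_preimage_subset q hU₂
  obtain ⟨d₁, d₂, hd⟩ := RightOre.ore c₁ c₂
  have h₁ : p * c₁ * d₁ = p * (c₁ * d₁) := mul_assoc _ _ _
  have h₂ : q * c₂ * d₂ = q * (c₁ * d₁) := by rw [mul_assoc, hd]
  refine ⟨c₁ * d₁, (A.resPos d₁ h₁ ⁻¹' N₁) ×ˢ (A.resPos d₂ h₂ ⁻¹' N₂),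
    (hN₁.preimage (A.continuous_resPos d₁ h₁)).prod (hN₂.preimage (A.continuous_resPos d₂ h₂)), ?_⟩
  simp only [mem_prod, mem_preimage, resPos_pos]
  exact ⟨⟨hx, hy⟩, fun x' y' h => hU₁₂ ⟨hNU₁ h.1, hNU₂ h.2⟩⟩

theorem exists_pos_preimage_between {K V : Set A.History} (hK : IsCompact K) (hV : IsOpen V)
    (hKV : K ⊆ V) :
    ∃ k, ∃ O : Set (A.MPos k), IsOpen O ∧ K ⊆ A.pos k ⁻¹' O ∧ A.pos k ⁻¹' O ⊆ V := by
  refine hK.induction_on (p := fun S => ∃ k, ∃ O : Set (A.MPos k), IsOpen O ∧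
    S ⊆ A.pos k ⁻¹' O ∧ A.pos k ⁻¹' O ⊆ V) ?_ ?_ ?_ ?_
  · exact ⟨1, ∅, isOpen_empty, empty_subset _, empty_subset _⟩
  · rintro S T hST ⟨k, O, hO, hTO, hOV⟩
    exact ⟨k, O, hO, hST.trans hTO, hOV⟩
  · rintro S T ⟨k, O, hO, hSO, hOV⟩ ⟨l, O', hO', hTO', hOV'⟩
    obtain ⟨c, d, hcd⟩ := RightOre.ore k l
    refine ⟨k * c, A.resPos c rfl ⁻¹' O ∪ A.resPos d hcd.symm ⁻¹' O',
      (hO.preimage (A.continuous_resPos _ _)).union (hO'.preimage (A.continuous_resPos _ _)), ?_⟩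
    simp only [preimage_union, ← preimage_comp, Function.comp_def, resPos_pos]
    exact ⟨union_subset_union hSO hTO', union_subset hOV hOV'⟩
  · intro x hx
    obtain ⟨c, N, hN, hxN, hNV⟩ := A.exists_pos_preimage_subset 1 (hV.mem_nhds (hKV hx))
    exact ⟨_, mem_nhdsWithin_of_mem_nhds ((hN.preimage (A.continuous_pos _)).mem_nhds hxN),
      1 * c, N, hN, subset_rfl, hNV⟩

end Levels

/-! ### Arrows and cylinders -/

variable [RightOre P]

open FracGroup

section Arrows

theorem toArrow_surjective : Function.Surjective A.toArrow := fun a => by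
  obtain ⟨p, q, hg, h⟩ := a.prop
  exact ⟨⟨(p, q), (a.x, a.y), h⟩, Arrow.ext' A rfl hg.symm rfl⟩

theorem continuous_toArrow : Continuous A.toArrow := continuous_coinduced_rng

theorem isOpen_arrow_iff {B : Set A.Arrow} : IsOpen B ↔ ∀ p q : P,
    IsOpen {z : (A.shift p).Pullback (A.shift q) | A.toArrow ⟨(p, q), z⟩ ∈ B} := by
  rw [isOpen_coinduced, isOpen_sigma_iff, Prod.forall]
  rfl

theorem continuous_arrow_x : Continuous (Arrow.x : A.Arrow → A.History) :=
  continuous_coinduced_dom.2 <| continuous_sigma fun _ =>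
    continuous_fst.comp continuous_subtype_val

theorem continuous_arrow_y : Continuous (Arrow.y : A.Arrow → A.History) :=
  continuous_coinduced_dom.2 <| continuous_sigma fun _ =>
    continuous_snd.comp continuous_subtype_val

theorem isOpenMap_arrow_x : IsOpenMap (Arrow.x : A.Arrow → A.History) :=
  .of_comp A.continuous_toArrow A.toArrow_surjective <| isOpenMap_sigma.2 fun pq =>
    isOpenMap_pullback_fst (A.continuous_shift pq.1) (A.isOpenMap_shift pq.2)

theorem isOpenMap_arrow_y : IsOpenMap (Arrow.y : A.Arrow → A.History) :=
  .of_comp A.continuous_toArrow A.toArrow_surjective <| isOpenMap_sigma.2 fun pq =>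
    isOpenMap_pullback_snd (A.isOpenMap_shift pq.1) (A.continuous_shift pq.2)

theorem isOpen_setOf_g_mem (Γ : Set (FracGroup P)) : IsOpen {a : A.Arrow | a.g ∈ Γ} :=
  A.isOpen_arrow_iff.2 fun p q => isOpen_const (p := frac p q ∈ Γ)

variable {A}

/-- The inverse of an arrow of the transformation groupoid. -/
noncomputable def Arrow.inv (a : A.Arrow) : A.Arrow :=
  A.transformationGroupoid.inv a

theorem Arrow.inv_inv (a : A.Arrow) : a.inv.inv = a :=
  Arrow.ext' A rfl (_root_.inv_inv a.g) rfl

theorem image_y_eq_image_x_inv (B : Set A.Arrow) :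
    Arrow.y '' B = Arrow.x '' (Arrow.inv ⁻¹' B) := by
  rw [← (show Function.Involutive _ from Arrow.inv_inv).image_eq_preimage_symm, image_image]
  rfl

theorem injOn_y_iff_injOn_x_inv {B : Set A.Arrow} :
    InjOn Arrow.y B ↔ InjOn Arrow.x (Arrow.inv ⁻¹' B) := by
  have hinv : Function.Involutive (Arrow.inv : A.Arrow → A.Arrow) := Arrow.inv_inv
  rw [← hinv.image_eq_preimage_symm, ← hinv.injective.injOn.comp_iff]
  rfl

end Arrows

section Cylinders

/-- The arrows `(x, p q⁻¹, y)` with `s̃_p(x) = s̃_q(y)` whose positions `(x_p, y_q)` lie in `W`.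
For open `W` these sets form a base of the topology on arrows. -/
def cylinder (p q : P) (W : Set (A.MPos p × A.MPos q)) : Set A.Arrow :=
  {a | a.g = frac p q ∧ A.shift p a.x = A.shift q a.y ∧ (A.pos p a.x, A.pos q a.y) ∈ W}

variable {A} {p q : P}

theorem inv_preimage_cylinder (W : Set (A.MPos p × A.MPos q)) :
    Arrow.inv ⁻¹' A.cylinder p q W = A.cylinder q p (Prod.swap ⁻¹' W) := by
  ext a
  exact and_congr (inv_eq_iff_eq_inv (a := a.g) (b := frac p q)) (and_congr eq_comm Iff.rfl)

theorem sPos_eq_of_mem_cylinder {a : A.Arrow} {W : Set (A.MPos p × A.MPos q)}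
    (ha : a ∈ A.cylinder p q W) : A.sPos p (A.pos p a.x) = A.sPos q (A.pos q a.y) := by
  rw [sPos_pos, sPos_pos, ha.2.1]

variable (A) in
theorem isOpen_cylinder {O : Set (A.MPos p × A.MPos q)} (hO : IsOpen O) :
    IsOpen (A.cylinder p q O) := by
  refine A.isOpen_arrow_iff.2 fun p' q' => ?_
  by_cases hg : frac p' q' = frac p q
  swap
  · convert isOpen_empty
    exact eq_empty_of_forall_notMem fun z hz => hg hz.1
  obtain ⟨t', t, hp, hq⟩ := frac_eq_iff.1 hg
  have hshift : IsOpen {z : (A.shift p').Pullback (A.shift q') |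
      A.shift p z.1.1 = A.shift q z.1.2} :=
    (A.isLocallyInjective_shift t).isOpen_eqLocus
      ((A.continuous_shift p).comp (continuous_fst.comp continuous_subtype_val))
      ((A.continuous_shift q).comp (continuous_snd.comp continuous_subtype_val))
      (funext fun z => by
        simp only [Function.comp_apply]
        rw [← shift_mul, ← shift_mul, ← hp, ← hq, shift_mul, shift_mul, z.2])
  have hpos : IsOpen {z : (A.shift p').Pullback (A.shift q') |
      (A.pos p z.1.1, A.pos q z.1.2) ∈ O} :=
    hO.preimage <| ((A.continuous_pos p).prodMap (A.continuous_pos q)).comp continuous_subtype_val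
  convert hshift.inter hpos using 1
  ext z
  exact and_iff_right hg

theorem exists_cylinder_eq_of_mul_eq {c p' q' : P} (hp : p * c = p') (hq : q * c = q')
    {O : Set (A.MPos p' × A.MPos q')} (hO : IsOpen O) :
    ∃ O' : Set (A.MPos p' × A.MPos q'), IsOpen O' ∧ A.cylinder p' q' O' =
      {a | a.g = frac p q ∧ A.shift p a.x = A.shift q a.y ∧ (A.pos p' a.x, A.pos q' a.y) ∈ O} := by
  subst hp hq
  -- If `s̃_{pc}(x) = s̃_{qc}(y)`, then `s̃_p(x) = s̃_q(y)` is an open condition on their positions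
  -- at level `c`, expressed by `D`.
  obtain ⟨D, hD, hdiag⟩ := exists_isOpen_eq_iff_mem (A.isLocallyInjective_sPos c)
  refine ⟨O ∩ Prod.map (A.ssPos p c) (A.ssPos q c) ⁻¹' D, hO.inter <|
    hD.preimage <| (A.continuous_ssPos p c).prodMap (A.continuous_ssPos q c), ?_⟩
  ext a
  have hshift : A.shift p a.x = A.shift q a.y ↔ A.shift (p * c) a.x = A.shift (q * c) a.y ∧
      (A.pos c (A.shift p a.x), A.pos c (A.shift q a.y)) ∈ D := by
    rw [shift_mul, shift_mul]
    refine ⟨fun h => ⟨by rw [h], (hdiag _ (by rw [h])).2 (by rw [h])⟩, fun ⟨h, hmem⟩ => ?_⟩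
    exact history_ext_pos ((hdiag _ (by rw [sPos_pos, sPos_pos, h])).1 hmem) h
  simp only [cylinder, mem_ofPred_eq, frac_mul_right, hshift, and_assoc]
  exact and_congr_right fun _ => and_congr_right fun _ => and_comm

theorem exists_cylinder_eq_cylinder {c p' q' : P} (hp : p * c = p') (hq : q * c = q')
    {O : Set (A.MPos p × A.MPos q)} (hO : IsOpen O) :
    ∃ O' : Set (A.MPos p' × A.MPos q'), IsOpen O' ∧ A.cylinder p' q' O' = A.cylinder p q O := by
  obtain ⟨O', hO', h⟩ := exists_cylinder_eq_of_mul_eq hp hq <|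
    hO.preimage <| (A.continuous_resPos c hp).prodMap (A.continuous_resPos c hq)
  refine ⟨O', hO', h.trans ?_⟩
  simp only [mem_preimage, Prod.map_apply, resPos_pos, cylinder]

theorem exists_cylinder_subset {B : Set A.Arrow} (hB : IsOpen B) {a : A.Arrow} (ha : a ∈ B) :
    ∃ p q, ∃ O : Set (A.MPos p × A.MPos q), IsOpen O ∧ a ∈ A.cylinder p q O ∧
      A.cylinder p q O ⊆ B := by
  obtain ⟨p, q, hg, hshift⟩ := a.prop
  obtain ⟨U, hU, hUB⟩ := isOpen_induced_iff.1 (A.isOpen_arrow_iff.1 hB p q)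
  have mem_U_iff {b : A.Arrow} (hbg : b.g = frac p q) (hb : A.shift p b.x = A.shift q b.y) :
      (b.x, b.y) ∈ U ↔ b ∈ B := by
    have h := Set.ext_iff.1 hUB ⟨(b.x, b.y), hb⟩
    rwa [mem_ofPred_eq, show A.toArrow ⟨(p, q), (b.x, b.y), hb⟩ = b from
      Arrow.ext' A rfl hbg.symm rfl] at h
  obtain ⟨c, O, hO, hmem, hOU⟩ :=
    A.exists_pos_prod_preimage_subset p q (hU.mem_nhds ((mem_U_iff hg hshift).2 ha))
  obtain ⟨O', hO', h⟩ := exists_cylinder_eq_of_mul_eq (p := p) (q := q) (c := c) rfl rfl hO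
  refine ⟨p * c, q * c, O', hO', h ▸ ⟨hg, hshift, hmem⟩, fun b hb => ?_⟩
  obtain ⟨hbg, hbshift, hbO⟩ := h ▸ hb
  exact (mem_U_iff hbg hbshift).1 (hOU _ _ hbO)

theorem exists_cylinder_between {γ : FracGroup P} {K B : Set A.Arrow} (hK : IsCompact K)
    (hB : IsOpen B) (hKB : K ⊆ B) (hγ : ∀ a ∈ K, a.g = γ) :
    ∃ p q, ∃ O : Set (A.MPos p × A.MPos q), IsOpen O ∧ frac p q = γ ∧
      K ⊆ A.cylinder p q O ∧ A.cylinder p q O ⊆ B := by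
  refine hK.induction_on (p := fun S => ∃ p q, ∃ O : Set (A.MPos p × A.MPos q), IsOpen O ∧
    frac p q = γ ∧ S ⊆ A.cylinder p q O ∧ A.cylinder p q O ⊆ B) ?_ ?_ ?_ ?_
  · obtain ⟨p, q, rfl⟩ := exists_frac γ
    exact ⟨p, q, ∅, isOpen_empty, rfl, empty_subset _, fun a ha => ha.2.2.elim⟩
  · rintro S T hST ⟨p, q, O, hO, hpq, hTO, hOB⟩
    exact ⟨p, q, O, hO, hpq, hST.trans hTO, hOB⟩
  · rintro S T ⟨p, q, O, hO, hpq, hSO, hOB⟩ ⟨p', q', O', hO', hpq', hTO', hOB'⟩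
    obtain ⟨t, t', hp, hq⟩ := frac_eq_iff.1 (hpq.trans hpq'.symm)
    obtain ⟨Q, hQ, hQO⟩ := exists_cylinder_eq_cylinder (c := t) rfl rfl hO
    obtain ⟨Q', hQ', hQO'⟩ := exists_cylinder_eq_cylinder hp.symm hq.symm hO'
    have hunion : A.cylinder (p * t) (q * t) (Q ∪ Q') = A.cylinder p q O ∪ A.cylinder p' q' O' := by
      rw [← hQO, ← hQO']
      ext a
      simp only [cylinder, mem_ofPred_eq, mem_union]
      tauto
    exact ⟨p * t, q * t, Q ∪ Q', hQ.union hQ', by rw [frac_mul_right, hpq],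
      hunion ▸ union_subset_union hSO hTO', hunion ▸ union_subset hOB hOB'⟩
  · intro a ha
    obtain ⟨p, q, O, hO, haO, hOB⟩ := exists_cylinder_subset hB (hKB ha)
    exact ⟨_, mem_nhdsWithin_of_mem_nhds ((A.isOpen_cylinder hO).mem_nhds haO), p, q, O, hO,
      haO.1.symm.trans (hγ a ha), subset_rfl, hOB⟩

theorem exists_cylinder_cover {K B : Set A.Arrow} (hK : IsCompact K) (hB : IsOpen B)
    (hKB : K ⊆ B) (k : P) :
    ∃ (n : ℕ) (p q : Fin n → P) (O : ∀ i, Set (A.MPos (p i) × A.MPos (q i))),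
      (∀ i, IsOpen (O i)) ∧ (∀ i, k ∣ q i) ∧ (Function.Injective fun i => frac (p i) (q i)) ∧
      K ⊆ ⋃ i, A.cylinder (p i) (q i) (O i) ∧ ⋃ i, A.cylinder (p i) (q i) (O i) ⊆ B := by
  obtain ⟨F, hF⟩ := hK.elim_finite_subcover (fun γ : FracGroup P => {a : A.Arrow | a.g = γ})
    (fun γ => A.isOpen_setOf_g_mem {γ}) fun a _ => mem_iUnion.2 ⟨a.g, rfl⟩
  have hpiece (γ : FracGroup P) : ∃ p q, ∃ O : Set (A.MPos p × A.MPos q), IsOpen O ∧ k ∣ q ∧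
      frac p q = γ ∧ K ∩ {a | a.g = γ} ⊆ A.cylinder p q O ∧ A.cylinder p q O ⊆ B := by
    have hclosed : IsClosed {a : A.Arrow | a.g = γ} := ⟨A.isOpen_setOf_g_mem {γ}ᶜ⟩
    obtain ⟨p, q, O, hO, hγ, hKO, hOB⟩ := exists_cylinder_between (hK.inter_right hclosed) hB
      (inter_subset_left.trans hKB) fun a ha => ha.2
    obtain ⟨c, d, hcd⟩ := RightOre.ore q k
    obtain ⟨O', hO', h⟩ := exists_cylinder_eq_cylinder (c := c) rfl rfl hO
    exact ⟨p * c, q * c, O', hO', ⟨d, hcd⟩, by rw [frac_mul_right, hγ], h ▸ hKO, h ▸ hOB⟩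
  choose p q O hO hk hγ hKO hOB using hpiece
  let γ : Fin F.card → FracGroup P := fun i => F.equivFin.symm i
  refine ⟨F.card, fun i => p (γ i), fun i => q (γ i), fun i => O (γ i), fun i => hO _,
    fun i => hk _, ?_, fun a ha => ?_, iUnion_subset fun i => hOB _⟩
  · simp only [hγ]
    exact Subtype.val_injective.comp F.equivFin.symm.injective
  · obtain ⟨δ, hδ, haδ⟩ := mem_iUnion₂.1 (hF ha)
    have hδγ : γ (F.equivFin ⟨δ, hδ⟩) = δ := by simp only [γ, Equiv.symm_apply_apply]
    exact mem_iUnion.2 ⟨F.equivFin ⟨δ, hδ⟩, hKO _ ⟨ha, haδ.trans hδγ.symm⟩⟩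

end Cylinders

variable {A}

section Images

variable {p q : P} {W : Set (A.MPos p × A.MPos q)}

theorem exists_mem_cylinder_of_pos_eq (hW : ∀ w ∈ W, A.sPos p w.1 = A.sPos q w.2)
    {w : A.MPos p × A.MPos q} (hw : w ∈ W) {x : A.History} (hx : A.pos p x = w.1) :
    ∃ a ∈ A.cylinder p q W, a.x = x ∧ A.pos q a.y = w.2 := by
  obtain ⟨y, hy, hxy⟩ := exists_pos_eq_shift_eq A (z := A.shift p x) (m := w.2) <| by
    rw [← hW w hw, ← hx, sPos_pos]
  exact ⟨⟨x, frac p q, y, p, q, rfl, hxy.symm⟩, ⟨rfl, hxy.symm, by rwa [hx, hy]⟩, rfl, hy⟩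

theorem image_x_cylinder (hW : ∀ w ∈ W, A.sPos p w.1 = A.sPos q w.2) :
    Arrow.x '' A.cylinder p q W = A.pos p ⁻¹' (Prod.fst '' W) := by
  refine Subset.antisymm (image_subset_iff.2 fun a ha => ⟨_, ha.2.2, rfl⟩) ?_
  rintro x ⟨w, hw, hwx⟩
  obtain ⟨a, ha, hax, -⟩ := exists_mem_cylinder_of_pos_eq hW hw hwx.symm
  exact ⟨a, ha, hax⟩

theorem image_y_cylinder (hW : ∀ w ∈ W, A.sPos p w.1 = A.sPos q w.2) :
    Arrow.y '' A.cylinder p q W = A.pos q ⁻¹' (Prod.snd '' W) := by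
  rw [image_y_eq_image_x_inv, inv_preimage_cylinder,
    image_x_cylinder (W := Prod.swap ⁻¹' W) fun w hw => (hW w.swap hw).symm,
    ← image_swap_eq_preimage_swap, image_image]
  rfl

theorem injOn_x_cylinder_iff (hW : ∀ w ∈ W, A.sPos p w.1 = A.sPos q w.2) :
    InjOn Arrow.x (A.cylinder p q W) ↔ InjOn Prod.fst W := by
  refine ⟨fun h w hw w' hw' hww' => ?_, fun h a ha b hb hab => ?_⟩
  · obtain ⟨x, hx⟩ := A.pos_surjective p w.1
    obtain ⟨a, ha, hax, hay⟩ := exists_mem_cylinder_of_pos_eq hW hw hx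
    obtain ⟨b, hb, hbx, hby⟩ := exists_mem_cylinder_of_pos_eq hW hw' (hx.trans hww')
    have hab : a = b := h ha hb (hax.trans hbx.symm)
    exact Prod.ext hww' (by rw [← hay, ← hby, hab])
  · have hpos := congrArg Prod.snd (h ha.2.2 hb.2.2 (congrArg (A.pos p) hab))
    exact Arrow.ext' A hab (ha.1.trans hb.1.symm)
      (history_ext_pos hpos (by rw [← ha.2.1, ← hb.2.1, hab]))

theorem injOn_y_cylinder_iff (hW : ∀ w ∈ W, A.sPos p w.1 = A.sPos q w.2) :
    InjOn Arrow.y (A.cylinder p q W) ↔ InjOn Prod.snd W := by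
  rw [injOn_y_iff_injOn_x_inv, inv_preimage_cylinder,
    injOn_x_cylinder_iff (W := Prod.swap ⁻¹' W) fun w hw => (hW w.swap hw).symm,
    ← image_swap_eq_preimage_swap,
    ← Prod.swap_injective.injOn.comp_iff]
  rfl

theorem isOpen_cylinder_of_isOpenMap_snd (hW : ∀ w ∈ W, A.sPos p w.1 = A.sPos q w.2)
    (hsnd : IsOpenMap fun w : W => w.1.2) : IsOpen (A.cylinder p q W) := by
  obtain ⟨O, hO, hOW⟩ := isOpen_induced_iff.1 <|
    isOpen_preimage_pullback_val (A.isLocallyInjective_sPos p) hW hsnd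
  convert A.isOpen_cylinder hO using 1
  ext a
  refine and_congr_right fun _ => and_congr_right fun h => ?_
  exact Set.ext_iff.1 hOW.symm ⟨(A.pos p a.x, A.pos q a.y), by rw [sPos_pos, sPos_pos, h]⟩

end Images

/-! ### Contraction of a single set -/

theorem isBisection_iff {B : Set A.Arrow} : A.transformationGroupoid.IsBisection B ↔
    IsOpen B ∧ InjOn Arrow.x B ∧ InjOn Arrow.y B := by
  refine and_congr_right fun hB => and_congr ?_ ?_
  · exact ⟨fun h => injOn_iff_injective.2 h.injective, fun h =>
      .of_continuous_injective_isOpenMap (A.continuous_arrow_x.comp continuous_subtype_val)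
        (injOn_iff_injective.1 h) (A.isOpenMap_arrow_x.domRestrict hB)⟩
  · exact ⟨fun h => injOn_iff_injective.2 h.injective, fun h =>
      .of_continuous_injective_isOpenMap (A.continuous_arrow_y.comp continuous_subtype_val)
        (injOn_iff_injective.1 h) (A.isOpenMap_arrow_y.domRestrict hB)⟩

section Families

variable {ι : Type*} {p q : ι → P} {W : ∀ i, Set (A.MPos (p i) × A.MPos (q i))}
  {a b : ι → P} {e : P}

theorem preimage_iUnion_extend_fst (hW : ∀ i, ∀ w ∈ W i, A.sPos (p i) w.1 = A.sPos (q i) w.2)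
    (hp : ∀ i, p i * a i = e) : A.pos e ⁻¹' ⋃ i, A.extend (hp i) (Prod.fst '' W i) =
      Arrow.x '' ⋃ i, A.cylinder (p i) (q i) (W i) := by
  simp only [preimage_iUnion, preimage_pos_extend, image_iUnion, image_x_cylinder (hW _)]

theorem preimage_iUnion_extend_snd (hW : ∀ i, ∀ w ∈ W i, A.sPos (p i) w.1 = A.sPos (q i) w.2)
    (hq : ∀ i, q i * b i = e) : A.pos e ⁻¹' ⋃ i, A.extend (hq i) (Prod.snd '' W i) =
      Arrow.y '' ⋃ i, A.cylinder (p i) (q i) (W i) := by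
  simp only [preimage_iUnion, preimage_pos_extend, image_iUnion, image_y_cylinder (hW _)]

theorem disjoint_extend_fst_iff (hW : ∀ i, ∀ w ∈ W i, A.sPos (p i) w.1 = A.sPos (q i) w.2)
    (hp : ∀ i, p i * a i = e) {i j : ι} :
    Disjoint (A.extend (hp i) (Prod.fst '' W i)) (A.extend (hp j) (Prod.fst '' W j)) ↔
      Disjoint (Arrow.x '' A.cylinder (p i) (q i) (W i))
        (Arrow.x '' A.cylinder (p j) (q j) (W j)) := by
  rw [← disjoint_preimage_iff (A.pos_surjective e), preimage_pos_extend, preimage_pos_extend,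
    image_x_cylinder (hW i), image_x_cylinder (hW j)]

theorem disjoint_extend_snd_iff (hW : ∀ i, ∀ w ∈ W i, A.sPos (p i) w.1 = A.sPos (q i) w.2)
    (hq : ∀ i, q i * b i = e) {i j : ι} :
    Disjoint (A.extend (hq i) (Prod.snd '' W i)) (A.extend (hq j) (Prod.snd '' W j)) ↔
      Disjoint (Arrow.y '' A.cylinder (p i) (q i) (W i))
        (Arrow.y '' A.cylinder (p j) (q j) (W j)) := by
  rw [← disjoint_preimage_iff (A.pos_surjective e), preimage_pos_extend, preimage_pos_extend,
    image_y_cylinder (hW i), image_y_cylinder (hW j)]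

end Families

variable (A) in
/-- The condition that local contractivity of the action imposes on a single set `S`. -/
def ContractsIn (S : Set A.possible) : Prop :=
  ∃ (n : ℕ) (p q a b : Fin n → P) (W : ∀ i, Set (A.MPos (p i) × A.MPos (q i)))
    (e : P) (hp : ∀ i, p i * a i = e) (hq : ∀ i, q i * b i = e),
    (∀ i, ∀ w ∈ W i, A.s (p i) w.1.1 = A.s (q i) w.2.1) ∧
    (∀ i, Function.Injective (fun w : W i => w.1.1) ∧ IsOpenMap (fun w : W i => w.1.1) ∧
      Function.Injective (fun w : W i => w.1.2) ∧ IsOpenMap (fun w : W i => w.1.2)) ∧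
    (∀ i j, i ≠ j → Disjoint (A.extend (hp i) (Prod.fst '' W i))
      (A.extend (hp j) (Prod.fst '' W j))) ∧
    (∀ i j, i ≠ j → Disjoint (A.extend (hq i) (Prod.snd '' W i))
      (A.extend (hq j) (Prod.snd '' W j))) ∧
    closure (⋃ i, A.extend (hp i) (Prod.fst '' W i)) ⊂
      (⋃ i, A.extend (hq i) (Prod.snd '' W i)) ∧
    (∀ i, ∀ w ∈ W i, A.r (q i) w.2.1 ∈ Subtype.val '' S) ∧
    (∀ i j, i ≠ j → FracGroup.frac (p i) (q i) ≠ FracGroup.frac (p j) (q j))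

theorem locallyContracting_iff : A.LocallyContracting ↔ ∀ S : Set A.possible, IsOpen S →
    IsCompact (closure S) → S.Nonempty → A.ContractsIn S :=
  Iff.rfl

section ActionToGroupoid

theorem isBisection_iUnion_cylinder {ι : Type*} {p q : ι → P}
    {W : ∀ i, Set (A.MPos (p i) × A.MPos (q i))}
    (hW : ∀ i, ∀ w ∈ W i, A.sPos (p i) w.1 = A.sPos (q i) w.2)
    (hfst : ∀ i, InjOn Prod.fst (W i)) (hsnd : ∀ i, InjOn Prod.snd (W i))
    (hopen : ∀ i, IsOpenMap fun w : W i => w.1.2)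
    (hx : Pairwise fun i j => Disjoint (Arrow.x '' A.cylinder (p i) (q i) (W i))
      (Arrow.x '' A.cylinder (p j) (q j) (W j)))
    (hy : Pairwise fun i j => Disjoint (Arrow.y '' A.cylinder (p i) (q i) (W i))
      (Arrow.y '' A.cylinder (p j) (q j) (W j))) :
    A.transformationGroupoid.IsBisection (⋃ i, A.cylinder (p i) (q i) (W i)) :=
  isBisection_iff.2 ⟨isOpen_iUnion fun i => isOpen_cylinder_of_isOpenMap_snd (hW i) (hopen i),
    injOn_iUnion_of_pairwise_disjoint_image (fun i => (injOn_x_cylinder_iff (hW i)).2 (hfst i)) hx,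
    injOn_iUnion_of_pairwise_disjoint_image (fun i => (injOn_y_cylinder_iff (hW i)).2 (hsnd i)) hy⟩

theorem contractsIn_of_isCompact_between [LocallyCompactSpace X] {B : Set A.Arrow}
    {J U : Set A.History} (hB : A.transformationGroupoid.IsBisection B) (hJ : IsCompact J)
    (hBJ : Arrow.x '' B ⊆ J) (hJB : J ⊂ Arrow.y '' B) (hBU : Arrow.y '' B ⊆ U) :
    A.transformationGroupoid.ContractsIn U := by
  obtain ⟨z, hzB, hzJ⟩ := exists_of_ssubset hJB
  obtain ⟨V, hV, hJV, hVB, -⟩ := exists_open_between_and_isCompact_closure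
    (hJ.union isCompact_singleton) (A.isOpenMap_arrow_y B hB.1)
    (union_subset hJB.subset (singleton_subset_iff.2 hzB))
  have hxJ : Arrow.x '' {β ∈ B | β.y ∈ closure V} ⊆ J := (image_mono (sep_subset _ _)).trans hBJ
  exact ⟨V, B, hV, subset_closure.trans (hVB.trans hBU), hB, hVB,
    hxJ.trans (subset_union_left.trans hJV), fun h => hzJ (hxJ (h (hJV (.inr rfl))))⟩

theorem ContractsIn.transformationGroupoid [LocallyCompactSpace X] {S : Set A.possible}
    (hS : IsCompact (closure S)) (h : A.ContractsIn S) :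
    A.transformationGroupoid.ContractsIn (A.situation ⁻¹' S) := by
  obtain ⟨n, p, q, a, b, W, e, hp, hq, hW, hproj, hx, hy, hYZ, hr, -⟩ := h
  replace hW (i) (w) (hw : w ∈ W i) : A.sPos (p i) w.1 = A.sPos (q i) w.2 :=
    Subtype.ext (hW i w hw)
  set B := ⋃ i, A.cylinder (p i) (q i) (W i)
  set Y := ⋃ i, A.extend (hp i) (Prod.fst '' W i)
  set Z := ⋃ i, A.extend (hq i) (Prod.snd '' W i)
  have hY : A.pos e ⁻¹' Y = Arrow.x '' B := preimage_iUnion_extend_fst hW hp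
  have hZ : A.pos e ⁻¹' Z = Arrow.y '' B := preimage_iUnion_extend_snd hW hq
  have hB : A.transformationGroupoid.IsBisection B := isBisection_iUnion_cylinder hW
    (fun i => injOn_iff_injective.2 (hproj i).1) (fun i => injOn_iff_injective.2 (hproj i).2.2.1)
    (fun i => (hproj i).2.2.2) (fun i j hij => (disjoint_extend_fst_iff hW hp).1 (hx i j hij))
    (fun i j hij => (disjoint_extend_snd_iff hW hq).1 (hy i j hij))
  have hBS : Arrow.y '' B ⊆ A.situation ⁻¹' S := image_subset_iff.2 fun β hβ => by
    obtain ⟨i, hi⟩ := mem_iUnion.1 hβ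
    exact (A.r_pos_mem_image_iff).1 (hr i _ hi.2.2)
  have hYB : A.pos e ⁻¹' closure Y ⊂ Arrow.y '' B :=
    hZ ▸ (preimage_ssubset_preimage_iff (A.pos_surjective e)).2 hYZ
  have hYc : IsCompact (A.pos e ⁻¹' closure Y) :=
    (A.isCompact_preimage_situation hS).of_isClosed_subset
      (isClosed_closure.preimage (A.continuous_pos e)) <|
      hYB.subset.trans (hBS.trans (preimage_mono subset_closure))
  exact contractsIn_of_isCompact_between hB hYc (hY ▸ preimage_mono subset_closure) hYB hBS

end ActionToGroupoid

section GroupoidToAction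

variable (A) in
/-- The part of `O` in the fibre product `M'_p ×_{X'} M'_q` whose second coordinate restricts to a
point of `T ⊆ M'_k`, where `q = k c`. -/
def slice {p q k : P} (c : P) (h : k * c = q) (O : Set (A.MPos p × A.MPos q))
    (T : Set (A.MPos k)) : Set (A.MPos p × A.MPos q) :=
  {w | (w ∈ O ∧ A.resPos c h w.2 ∈ T) ∧ A.sPos p w.1 = A.sPos q w.2}

theorem cylinder_slice {p q k c : P} (h : k * c = q) (O : Set (A.MPos p × A.MPos q))
    (T : Set (A.MPos k)) :
    A.cylinder p q (A.slice c h O T) = {a ∈ A.cylinder p q O | A.pos k a.y ∈ T} := by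
  ext a
  refine ⟨fun ha => ⟨⟨ha.1, ha.2.1, ha.2.2.1.1⟩, ?_⟩, fun ha =>
    ⟨ha.1.1, ha.1.2.1, ⟨ha.1.2.2, ?_⟩, sPos_eq_of_mem_cylinder ha.1⟩⟩
  · exact A.resPos_pos c h a.y ▸ ha.2.2.1.2
  · exact (A.resPos_pos c h a.y).symm ▸ ha.2

theorem isOpenMap_slice {p q k c : P} (h : k * c = q) {O : Set (A.MPos p × A.MPos q)}
    (hO : IsOpen O) {N : Set (A.MPos k)} (hN : IsOpen N) :
    (IsOpenMap fun w : A.slice c h O N => w.1.1) ∧ IsOpenMap fun w : A.slice c h O N => w.1.2 :=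
  have hopen := hO.inter (hN.preimage ((A.continuous_resPos c h).comp continuous_snd))
  ⟨isOpenMap_fst_of_isOpen (A.continuous_sPos p) (A.isOpenMap_sPos q) hopen,
    isOpenMap_snd_of_isOpen (A.isOpenMap_sPos p) (A.continuous_sPos q) hopen⟩

section Slices

variable {ι : Type*} {k : P} {p q c : ι → P} {O : ∀ i, Set (A.MPos (p i) × A.MPos (q i))}

theorem iUnion_cylinder_slice (hc : ∀ i, k * c i = q i) (T : Set (A.MPos k)) :
    ⋃ i, A.cylinder (p i) (q i) (A.slice (c i) (hc i) (O i) T) =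
      {β ∈ ⋃ i, A.cylinder (p i) (q i) (O i) | A.pos k β.y ∈ T} := by
  ext β
  simp only [cylinder_slice, mem_iUnion, mem_ofPred_eq, exists_and_right]

theorem pairwise_disjoint_image_cylinder {W : ∀ i, Set (A.MPos (p i) × A.MPos (q i))}
    (hpq : Function.Injective fun i => frac (p i) (q i)) {Y : Type*} {f : A.Arrow → Y}
    (hf : InjOn f (⋃ i, A.cylinder (p i) (q i) (W i))) :
    Pairwise fun i j => Disjoint (f '' A.cylinder (p i) (q i) (W i))
      (f '' A.cylinder (p j) (q j) (W j)) := fun i j hij =>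
  have hdisj : Disjoint (A.cylinder (p i) (q i) (W i)) (A.cylinder (p j) (q j) (W j)) :=
    disjoint_left.2 fun _ hi hj => hij (hpq (hi.1.symm.trans hj.1))
  hdisj.image hf (subset_iUnion_of_subset i subset_rfl) (subset_iUnion_of_subset j subset_rfl)

end Slices

theorem contractsIn_of_isClosed_between {S : Set A.possible} {n : ℕ} {p q a b : Fin n → P} {e : P}
    (hp : ∀ i, p i * a i = e) (hq : ∀ i, q i * b i = e)
    (hpq : Function.Injective fun i => frac (p i) (q i))
    {W : ∀ i, Set (A.MPos (p i) × A.MPos (q i))}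
    (hW : ∀ i, ∀ w ∈ W i, A.sPos (p i) w.1 = A.sPos (q i) w.2)
    (hfst : ∀ i, IsOpenMap fun w : W i => w.1.1) (hsnd : ∀ i, IsOpenMap fun w : W i => w.1.2)
    {B : Set A.Arrow} (hB : B = ⋃ i, A.cylinder (p i) (q i) (W i)) (hx : InjOn Arrow.x B)
    (hy : InjOn Arrow.y B) (hBS : Arrow.y '' B ⊆ A.situation ⁻¹' S) {C : Set (A.MPos e)}
    (hC : IsClosed C) (hBC : Arrow.x '' B ⊆ A.pos e ⁻¹' C) (hCB : A.pos e ⁻¹' C ⊂ Arrow.y '' B) :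
    A.ContractsIn S := by
  subst hB
  have hsub (i) := subset_iUnion (fun i => A.cylinder (p i) (q i) (W i)) i
  rw [← preimage_iUnion_extend_fst hW hp, (A.pos_surjective e).preimage_subset_preimage_iff] at hBC
  rw [← preimage_iUnion_extend_snd hW hq, preimage_ssubset_preimage_iff (A.pos_surjective e)] at hCB
  refine ⟨n, p, q, a, b, W, e, hp, hq, fun i w hw => congrArg Subtype.val (hW i w hw),
    fun i => ⟨?_, hfst i, ?_, hsnd i⟩,
    fun i j hij => (disjoint_extend_fst_iff hW hp).2 (pairwise_disjoint_image_cylinder hpq hx hij),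
    fun i j hij => (disjoint_extend_snd_iff hW hq).2 (pairwise_disjoint_image_cylinder hpq hy hij),
    (closure_minimal hBC hC).trans_ssubset hCB, fun i w hw => ?_, fun i j => hpq.ne⟩
  · exact injOn_iff_injective.1 ((injOn_x_cylinder_iff (hW i)).1 (hx.mono (hsub i)))
  · exact injOn_iff_injective.1 ((injOn_y_cylinder_iff (hW i)).1 (hy.mono (hsub i)))
  · obtain ⟨x, hx⟩ := A.pos_surjective (p i) w.1
    obtain ⟨β, hβ, -, hβw⟩ := exists_mem_cylinder_of_pos_eq (hW i) hw hx
    exact hβw ▸ A.r_pos_mem_image_iff.2 (hBS ⟨β, hsub i hβ, rfl⟩)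

theorem contractsIn_of_iUnion_cylinder {S : Set A.possible} {n : ℕ} {p q : Fin n → P} {k : P}
    (hk : ∀ i, k ∣ q i) {O : ∀ i, Set (A.MPos (p i) × A.MPos (q i))}
    (hO : ∀ i, IsOpen (O i)) (hpq : Function.Injective fun i => frac (p i) (q i))
    {B : Set A.Arrow} (hB : B = ⋃ i, A.cylinder (p i) (q i) (O i)) (hx : InjOn Arrow.x B)
    (hy : InjOn Arrow.y B) {N L : Set (A.MPos k)} (hN : IsOpen N) (hNL : N ⊆ L)
    (hNB : A.pos k ⁻¹' N ⊆ Arrow.y '' B) (hNS : A.pos k ⁻¹' N ⊆ A.situation ⁻¹' S)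
    (hL : IsCompact {β ∈ B | A.pos k β.y ∈ L})
    (hLN : Arrow.x '' {β ∈ B | A.pos k β.y ∈ L} ⊂ A.pos k ⁻¹' N) : A.ContractsIn S := by
  choose c hc using hk
  replace hc (i) := (hc i).symm
  obtain ⟨e, a, b, ha, hb⟩ := RightOre.exists_forall_mul_eq p q
  let W (T : Set (A.MPos k)) (i) := A.slice (c i) (hc i) (O i) T
  have hW (T) (i) : ∀ w ∈ W T i, A.sPos (p i) w.1 = A.sPos (q i) w.2 := fun w hw => hw.2
  have hWB (T) : ⋃ i, A.cylinder (p i) (q i) (W T i) = {β ∈ B | A.pos k β.y ∈ T} :=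
    hB ▸ iUnion_cylinder_slice hc T
  have hBN : Arrow.y '' {β ∈ B | A.pos k β.y ∈ N} = A.pos k ⁻¹' N := by
    rw [show {β ∈ B | A.pos k β.y ∈ N} = B ∩ Arrow.y ⁻¹' (A.pos k ⁻¹' N) from rfl,
      image_inter_preimage, inter_eq_right.2 hNB]
  let C := ⋃ i, A.extend (ha i) (Prod.fst '' W L i)
  have hC : A.pos e ⁻¹' C = Arrow.x '' {β ∈ B | A.pos k β.y ∈ L} := by
    rw [preimage_iUnion_extend_fst (hW L) ha, hWB]
  have hCclosed : IsClosed C := by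
    rw [← image_preimage_eq C (A.pos_surjective e), hC]
    exact ((hL.image A.continuous_arrow_x).image (A.continuous_pos e)).isClosed
  exact contractsIn_of_isClosed_between ha hb hpq (hW N)
    (fun i => (isOpenMap_slice (hc i) (hO i) hN).1) (fun i => (isOpenMap_slice (hc i) (hO i) hN).2)
    (hWB N).symm (hx.mono (sep_subset _ _)) (hy.mono (sep_subset _ _)) (hBN.trans_subset hNS)
    hCclosed (hC ▸ image_mono fun β hβ => ⟨hβ.1, hNL hβ.2⟩) (by rwa [hC, hBN])

theorem exists_isOpen_isCompact_between {K V : Set A.History}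
    (hK : IsCompact K) (hV : IsOpen V) (hKV : K ⊆ V) :
    ∃ (k : P) (N L : Set (A.MPos k)), IsOpen N ∧ IsCompact L ∧ K ⊆ A.pos k ⁻¹' N ∧ N ⊆ L ∧
      A.pos k ⁻¹' L ⊆ V := by
  obtain ⟨k, O, hO, hKO, hOV⟩ := A.exists_pos_preimage_between hK hV hKV
  obtain ⟨L, hL, hKL, hLO⟩ :=
    exists_compact_between (hK.image (A.continuous_pos k)) hO (image_subset_iff.2 hKO)
  exact ⟨k, interior L, L, isOpen_interior, hL, image_subset_iff.1 hKL, interior_subset,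
    (preimage_mono hLO).trans hOV⟩

theorem contractsIn_of_transformationGroupoid {S : Set A.possible}
    (hS : IsCompact (closure S))
    (h : A.transformationGroupoid.ContractsIn (A.situation ⁻¹' S)) : A.ContractsIn S := by
  obtain ⟨V, B, hV, hVS, hB, hVB, hBV⟩ := h
  obtain ⟨hBopen, hx, hy⟩ := isBisection_iff.1 hB
  have hVc : IsCompact (closure V) := (A.isCompact_preimage_situation hS).closure_of_subset
    (hVS.trans (preimage_mono subset_closure))
  set K : Set A.Arrow := {β ∈ B | β.y ∈ closure V}
  have hK : IsCompact K := hB.isCompact_source_preimage hVc hVB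
  -- Keeping `v` in the smaller set `pos k ⁻¹' N` makes the inclusion there strict as well.
  obtain ⟨v, hvV, hvK⟩ : ∃ v ∈ V, v ∉ Arrow.x '' K := exists_of_ssubset hBV
  obtain ⟨k, N, L, hN, hL, hKN, hNL, hLV⟩ := exists_isOpen_isCompact_between
    ((hK.image A.continuous_arrow_x).union isCompact_singleton) hV
    (union_subset hBV.subset (singleton_subset_iff.2 hvV))
  obtain ⟨n, p, q, O, hO, hk, hpq, hKB', hB'B⟩ :=
    exists_cylinder_cover hK hBopen (sep_subset _ _) k
  set B' := ⋃ i, A.cylinder (p i) (q i) (O i)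
  have hLB' : A.pos k ⁻¹' L ⊆ Arrow.y '' B' := fun y hy => by
    obtain ⟨β, hβ, rfl⟩ := hVB (subset_closure (hLV hy))
    exact ⟨β, hKB' ⟨hβ, subset_closure (hLV hy)⟩, rfl⟩
  have hLc : IsCompact {β ∈ B' | A.pos k β.y ∈ L} := by
    have hB' : A.transformationGroupoid.IsBisection B' := isBisection_iff.2
      ⟨isOpen_iUnion fun i => A.isOpen_cylinder (hO i), hx.mono hB'B, hy.mono hB'B⟩
    exact hB'.isCompact_source_preimage (hVc.of_isClosed_subset
      (hL.isClosed.preimage (A.continuous_pos k)) (hLV.trans subset_closure)) hLB'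
  have hLK : Arrow.x '' {β ∈ B' | A.pos k β.y ∈ L} ⊆ Arrow.x '' K :=
    image_mono fun β hβ => ⟨hB'B hβ.1, subset_closure (hLV hβ.2)⟩
  exact contractsIn_of_iUnion_cylinder hk hO hpq rfl (hx.mono hB'B) (hy.mono hB'B) hN hNL
    ((preimage_mono hNL).trans hLB') ((preimage_mono hNL).trans (hLV.trans hVS)) hLc
    ⟨hLK.trans (subset_union_left.trans hKN), fun h => hvK (hLK (h (hKN (.inr rfl))))⟩

end GroupoidToAction

section Conjugation

variable {t : P} {N N' : Set (A.MPos t)} {B : Set A.Arrow}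

theorem injOn_shift (hN : InjOn (A.sPos t) N) : InjOn (A.shift t) (A.pos t ⁻¹' N) :=
  fun x hx y hy h => history_ext_pos (hN hx hy (by rw [sPos_pos, sPos_pos, h])) h

theorem image_shift_preimage_pos (N : Set (A.MPos t)) :
    A.shift t '' (A.pos t ⁻¹' N) = A.situation ⁻¹' (A.sPos t '' N) := by
  refine Subset.antisymm (image_subset_iff.2 fun x hx => ⟨_, hx, A.sPos_pos t x⟩) ?_
  rintro z ⟨m, hm, hmz⟩
  obtain ⟨x, rfl, hxz⟩ := A.exists_pos_eq_shift_eq hmz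
  exact ⟨x, hm, hxz⟩

/-- The set of arrows `b_x β b_y⁻¹` with `β ∈ B`, where `b_x = (x, t, s̃_t(x))` for `x_t ∈ N`. -/
def conj (t : P) (N : Set (A.MPos t)) (B : Set A.Arrow) : Set A.Arrow :=
  {α | A.pos t α.x ∈ N ∧ A.pos t α.y ∈ N ∧ ∃ β ∈ B, β.x = A.shift t α.x ∧ β.y = A.shift t α.y ∧
    α.g = frac t 1 * β.g * (frac t 1)⁻¹}

theorem exists_arrow_of_shift_eq (β : A.Arrow) {x y : A.History} (hx : A.shift t x = β.x)
    (hy : A.shift t y = β.y) :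
    ∃ α : A.Arrow, α.x = x ∧ α.y = y ∧ α.g = frac t 1 * β.g * (frac t 1)⁻¹ := by
  obtain ⟨p, q, hg, h⟩ := β.prop
  refine ⟨⟨x, frac (t * p) (t * q), y, t * p, t * q, rfl, ?_⟩, rfl, rfl, ?_⟩
  · rw [shift_mul, shift_mul, hx, hy, h]
  · exact hg ▸ frac_mul_left t p q

theorem isOpen_conj (hN : IsOpen N) (hB : IsOpen B) : IsOpen (conj t N B) := by
  refine isOpen_iff_mem_nhds.2 ?_
  rintro α ⟨hx, hy, β, hβ, hβx, hβy, hg⟩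
  obtain ⟨p, q, O, hO, hβO, hOB⟩ := exists_cylinder_subset hB hβ
  let O' : Set (A.MPos (t * p) × A.MPos (t * q)) :=
    (A.resPos p rfl ⁻¹' N) ×ˢ (A.resPos q rfl ⁻¹' N) ∩ Prod.map (A.ssPos t p) (A.ssPos t q) ⁻¹' O
  have hO' : IsOpen O' :=
    ((hN.preimage (A.continuous_resPos p rfl)).prod (hN.preimage (A.continuous_resPos q rfl))).inter
      (hO.preimage ((A.continuous_ssPos t p).prodMap (A.continuous_ssPos t q)))
  have hmem {x y : A.History} : (A.pos (t * p) x, A.pos (t * q) y) ∈ O' ↔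
      (A.pos t x ∈ N ∧ A.pos t y ∈ N) ∧ (A.pos p (A.shift t x), A.pos q (A.shift t y)) ∈ O := by
    simp only [O', mem_inter_iff, mem_prod, mem_preimage, resPos_pos]
    rfl
  refine Filter.mem_of_superset ((A.isOpen_cylinder hO').mem_nhds ?_) fun α' hα' => ?_
  · refine ⟨?_, ?_, hmem.2 ⟨⟨hx, hy⟩, hβx ▸ hβy ▸ hβO.2.2⟩⟩
    · rw [hg, hβO.1, frac_mul_left]
    · rw [shift_mul, shift_mul, ← hβx, ← hβy, hβO.2.1]
  · obtain ⟨hg', hshift, hO''⟩ := hα'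
    obtain ⟨⟨hx', hy'⟩, hpos⟩ := hmem.1 hO''
    rw [shift_mul, shift_mul] at hshift
    exact ⟨hx', hy', ⟨A.shift t α'.x, frac p q, A.shift t α'.y, p, q, rfl, hshift⟩,
      hOB ⟨rfl, hshift, hpos⟩, rfl, rfl, by rw [hg', frac_mul_left]⟩

theorem isBisection_conj (hN : IsOpen N) (hinj : InjOn (A.sPos t) N)
    (hB : A.transformationGroupoid.IsBisection B) :
    A.transformationGroupoid.IsBisection (conj t N B) := by
  obtain ⟨hBopen, hx, hy⟩ := isBisection_iff.1 hB
  refine isBisection_iff.2 ⟨isOpen_conj hN hBopen, ?_, ?_⟩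
  · rintro α ⟨-, hα, β, hβ, hβx, hβy, hβg⟩ α' ⟨-, hα', β', hβ', hβx', hβy', hβg'⟩ h
    obtain rfl : β = β' := hx hβ hβ' (by rw [hβx, hβx', h])
    exact Arrow.ext' A h (hβg.trans hβg'.symm) (injOn_shift hinj hα hα' (hβy.symm.trans hβy'))
  · rintro α ⟨hα, -, β, hβ, hβx, hβy, hβg⟩ α' ⟨hα', -, β', hβ', hβx', hβy', hβg'⟩ h
    obtain rfl : β = β' := hy hβ hβ' (by rw [hβy, hβy', h])
    exact Arrow.ext' A (injOn_shift hinj hα hα' (hβx.symm.trans hβx')) (hβg.trans hβg'.symm) h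

theorem contractsIn_preimage_pos (hN : IsOpen N) (hN' : IsOpen N') (hNN' : closure N ⊆ N')
    (hinj : InjOn (A.sPos t) N')
    (h : A.transformationGroupoid.ContractsIn (A.situation ⁻¹' (A.sPos t '' N))) :
    A.transformationGroupoid.ContractsIn (A.pos t ⁻¹' N) := by
  obtain ⟨V, B, hV, hVN, hB, hVB, hBV⟩ := h
  replace hVN : V ⊆ A.shift t '' (A.pos t ⁻¹' N) :=
    hVN.trans (image_shift_preimage_pos N).superset
  have hsub : A.pos t ⁻¹' N ⊆ A.pos t ⁻¹' N' := preimage_mono (subset_closure.trans hNN')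
  have hBV' {β : A.Arrow} (hβ : β ∈ B) (hy : β.y ∈ closure V) : β.x ∈ V :=
    hBV.subset ⟨β, ⟨hβ, hy⟩, rfl⟩
  let V' := A.pos t ⁻¹' N ∩ A.shift t ⁻¹' V
  have hpos : closure V' ⊆ A.pos t ⁻¹' N' :=
    (closure_minimal (inter_subset_left.trans (preimage_mono subset_closure))
      (isClosed_closure.preimage (A.continuous_pos t))).trans (preimage_mono hNN')
  have hshift : MapsTo (A.shift t) (closure V') (closure V) :=
    (mapsTo_preimage _ _).mono_left inter_subset_right |>.closure (A.continuous_shift t)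
  refine ⟨V', conj t N' B, (hN.preimage (A.continuous_pos t)).inter
    (hV.preimage (A.continuous_shift t)), inter_subset_left, isBisection_conj hN' hinj hB,
    fun y hy => ?_, ?_, fun hsup => ?_⟩
  · obtain ⟨β, hβ, hβy : β.y = _⟩ := hVB (hshift hy)
    obtain ⟨x, hxN, hxβ⟩ := hVN (hBV' hβ (hβy ▸ hshift hy))
    obtain ⟨α, rfl, rfl, hg⟩ := exists_arrow_of_shift_eq β hxβ hβy.symm
    exact ⟨α, ⟨hsub hxN, hpos hy, β, hβ, hxβ.symm, hβy, hg⟩, rfl⟩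
  · rintro _ ⟨α, ⟨⟨hαx, -, β, hβ, hβx, hβy, -⟩, hα⟩, rfl⟩
    have hxV : A.shift t α.x ∈ V := hβx ▸ hBV' hβ (hβy ▸ hshift hα)
    obtain ⟨x, hxN, hx⟩ := hVN hxV
    have hxα : x = α.x := injOn_shift hinj (hsub hxN) hαx hx
    exact ⟨(hxα ▸ hxN : A.pos t α.x ∈ N), hxV⟩
  · obtain ⟨v, hv, hvB⟩ := exists_of_ssubset hBV
    obtain ⟨x, hxN, rfl⟩ := hVN hv
    obtain ⟨α, ⟨⟨-, -, β, hβ, hβx, hβy, -⟩, hα⟩, rfl⟩ := hsup ⟨hxN, hv⟩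
    exact hvB ⟨β, ⟨hβ, (hβy ▸ hshift hα : β.y ∈ closure V)⟩, hβx⟩

theorem exists_pos_preimage_subset_injOn {x : A.History} {U : Set A.History} (hU : U ∈ 𝓝 x) :
    ∃ (t : P) (N N' : Set (A.MPos t)), IsOpen N ∧ IsCompact (closure N) ∧ A.pos t x ∈ N ∧
      IsOpen N' ∧ closure N ⊆ N' ∧ InjOn (A.sPos t) N' ∧ A.pos t ⁻¹' N ⊆ U := by
  obtain ⟨c, N₁, hN₁, hxN₁, hN₁U⟩ := A.exists_pos_preimage_subset 1 hU
  obtain ⟨N₂, hN₂, hxN₂, hinj⟩ := A.isLocallyInjective_sPos (1 * c) (A.pos (1 * c) x)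
  obtain ⟨N, hN, hxN, hNN', hNc⟩ := exists_open_between_and_isCompact_closure
    (isCompact_singleton (x := A.pos (1 * c) x)) (hN₁.inter hN₂)
    (singleton_subset_iff.2 ⟨hxN₁, hxN₂⟩)
  exact ⟨1 * c, N, N₁ ∩ N₂, hN, hNc, hxN rfl, hN₁.inter hN₂, hNN', hinj.mono inter_subset_right,
    (preimage_mono (subset_closure.trans (hNN'.trans inter_subset_left))).trans hN₁U⟩

end Conjugation

end CorrAction

theorem mainTheorem12 {P : Type*} [Monoid P] [RightOre P]
    {X : Type*} [TopologicalSpace X] [T2Space X] [LocallyCompactSpace X]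
    (A : CorrAction P X) :
    A.transformationGroupoid.LocallyContracting ↔ A.LocallyContracting := by
  rw [SpaceGroupoid.locallyContracting_iff, CorrAction.locallyContracting_iff]
  constructor
  · intro hH S hS hSc hne
    exact CorrAction.contractsIn_of_transformationGroupoid hSc <| hH _
      (hS.preimage A.continuous_situation) (hne.preimage A.situation_surjective)
  · rintro hA U hU ⟨x, hx⟩
    obtain ⟨t, N, N', hN, hNc, hxN, hN', hNN', hinj, hNU⟩ :=
      CorrAction.exists_pos_preimage_subset_injOn (hU.mem_nhds hx)
    have hS : IsCompact (closure (A.sPos t '' N)) :=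
      (hNc.image (A.continuous_sPos t)).closure_of_subset (image_mono subset_closure)
    exact (CorrAction.contractsIn_preimage_pos hN hN' hNN' hinj <|
      CorrAction.ContractsIn.transformationGroupoid hS <|
        hA _ (A.isOpenMap_sPos t N hN) hS ⟨_, _, hxN, rfl⟩).mono hNU
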